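/- **Setting.** Let $(\Omega,P)$ be a probability space. A stochastic operator is $H f=\iint \eta(t,\nu)\,M_\nu T_t f\,dt\,d\nu$ with $M_\nu T_t f(x)=e^{2\pi i\nu x}f(x-t)$, where the stochastic spreading function $\eta(t,\nu)=\eta(t,\nu;\omega)$ is a jointly measurable process indexed by $\mathbb R^2$ with $\mathbb E\,\eta(t,\nu)=0$, $\mathbb E|\eta(t,\nu)|^2<\infty$ for all $(t,\nu)$, and $\eta(\cdot;\omega)\in L^2(\mathbb R^2)$ for all $\omega$. Its autocorrelation is $R_\eta(t,\nu;t',\nu')=\mathbb E[\eta(t,\nu)\overline{\eta(t',\nu')}]$, and for closed $U\subseteq\mathbb R^4$ we write $H\in\mathrm{StOPW}(U)$ if $\operatorname{supp}R_\eta\subseteq U$. For a tempered distribution $u$, $H(\omega)u$ is the distribution $\varphi\mapsto\iint\eta(t,\nu;\omega)\langle M_\nu T_t u,\varphi\rangle\,dt\,d\nu$ ($\varphi$ Schwartz, bilinear pairing). For $f\in L^2(\mathbb R)$ the (non-normalized) Zak transform is $\mathcal Z f(x,\nu)=\sum_{m\in\mathbb Z}f(x-amL)\,e^{2\pi i aLm\nu}$,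 the limit of the symmetric partial sums $\mathcal Z_Nf=\sum_{|m|\le N}$ being taken in $L^2$ on compact subsets of $\mathbb R^2$. A function $\chi:\mathbb R^2\to\mathbb C$ generates an $(a,b,\varepsilon)$-partition of unity if $\chi=0$ off $(-\varepsilon,a+\varepsilon)\times(-\varepsilon,b+\varepsilon)$ and $\sum_{k,n\in\mathbb Z}\chi(t+ak,\nu+bn)=1$ for all $(t,\nu)$. **Theorem.** Let $S\subset\mathbb R^2$ be compact with area $\mu(S)<1$. Then there exist a prime $L$, numbers $a,b>0$ with $ab=1/L$, $\varepsilon>0$, integers $(k_j,n_j)_{j=0}^{L-1}$ with $S\subseteq\bigcup_{j}\big([0,a)\times[0,b)+(ak_j,bn_j)\big)$, a vector $c\in\mathbb C^L$ and coefficients $(\alpha_{jp})_{j,p=0}^{L-1}$ — the inverse of the matrix $\big(e^{2\pi i n_jp/L}c_{p-k_j}\big)_{p,j=0}^{L-1}$ (indices of $c$ modulo $L$), hence depending only on $c$ and $(k_j,n_j)$ — such that the following holds for every probability space $(\Omega,P)$ and every $H\in\mathrm{StOPW}(S\times S)$. 1. The response $f=H\,\mathrm{III}_c$ of $H$ to the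 $L$-periodic $c$-weighted delta train $\mathrm{III}_c=\sum_{m\in\mathbb Z}c_{m\bmod L}\,\delta_{am}$ exists as a jointly measurable random function with $f(\cdot;\omega)\in L^2(\mathbb R)$ for almost every $\omega$, and its Zak transform $\mathcal Zf$ exists and has a jointly measurable version. 2. For every $\chi$ generating an $(a,b,\varepsilon)$-partition of unity, $\eta$ is recovered in the mean-square sense by $$\eta(t,\nu)\overset{m.s.}{=}aL\sum_{j=0}^{L-1}\sum_{p=0}^{L-1}\alpha_{jp}\,e^{-2\pi i\left(\nu(t+a(p-k_j))-ab\,n_jp\right)}\,\chi(t-ak_j,\nu-bn_j)\,(\mathcal Z f)(t+a(p-k_j),\nu-bn_j),$$ that is, for almost every $(t,\nu)\in\mathbb R^2$ the difference $D(t,\nu)$ of the two sides satisfies $\mathbb E|D(t,\nu)|^2=0$. 3. If moreover $\iint\mathbb E|\eta(t,\nu)|^2\,dt\,d\nu<\infty$ and $\chi$ is bounded, and $D_N$ denotes the difference of the two sides with $\mathcal Zf$ replaced by its partial sum $\mathcal Z_Nf$, then $\iint\mathbb E|D_N(t,\nu)|^2\,dt\,d\nu\to0$ as $N\to\infty$.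 -/

import Mathlib

open MeasureTheory Filter Topology Set
open scoped SchwartzMap ENNReal

noncomputable section

/-! ### Time-frequency shifts of tempered distributions and delta trains -/

/-- The character `x ↦ exp (2πiνx)`. -/
def character (ν : ℝ) (x : ℝ) : ℂ :=
  Complex.exp (2 * Real.pi * Complex.I * ν * x)

theorem norm_character (ν x : ℝ) : ‖character ν x‖ = 1 := by
  have h : (2 * Real.pi * Complex.I * ν * x : ℂ) = ((2 * Real.pi * ν * x : ℝ) : ℂ) * Complex.I := by
    push_cast; ring
  rw [character, h, Complex.norm_exp_ofReal_mul_I]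

theorem hasTemperateGrowth_character (ν : ℝ) : (character ν).HasTemperateGrowth := by
  have hd : ∀ n : ℕ, iteratedDeriv n (character ν) =
      fun x => (2 * Real.pi * Complex.I * ν : ℂ) ^ n * character ν x := by
    intro n
    induction n with
    | zero => ext x; simp
    | succ n ih =>
      rw [iteratedDeriv_succ, ih]
      ext x
      have h1 : HasDerivAt (fun y : ℝ => (2 * Real.pi * Complex.I * ν * y : ℂ))
          (2 * Real.pi * Complex.I * ν) x := by
        simpa using (Complex.ofRealCLM.hasDerivAt (x := x)).const_mul
          (2 * Real.pi * Complex.I * ν : ℂ)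
      have h2 := (h1.cexp.const_mul ((2 * Real.pi * Complex.I * ν : ℂ) ^ n)).deriv
      simp only [character]
      rw [h2]
      ring
  refine ⟨?_, fun n => ⟨0, ‖(2 * Real.pi * Complex.I * ν : ℂ) ^ n‖, fun x => ?_⟩⟩
  · have h : ContDiff ℝ (⊤ : ℕ∞) (fun x : ℝ => (2 * Real.pi * Complex.I * ν * (x : ℂ))) :=
      contDiff_const.mul Complex.ofRealCLM.contDiff
    exact h.cexp
  · rw [norm_iteratedFDeriv_eq_norm_iteratedDeriv, hd, norm_mul, norm_character]
    simp

/-- The time-frequency shift `M_ν T_t u` of a tempered distribution `u`; for functions this is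
`(M_ν T_t u)(x) = exp (2πiνx) u (x - t)`. -/
def timeFreqShift (t ν : ℝ) (u : 𝓢'(ℝ, ℂ)) : 𝓢'(ℝ, ℂ) :=
  TemperedDistribution.smulLeftCLM ℂ (character ν)
    (PointwiseConvergenceCLM.precomp ℂ (SchwartzMap.compSubConstCLM ℂ (-t)) u)

/-- On a point mass: `M_ν T_t δ_x = exp (2πiν(x+t)) δ_{x+t}`. -/
theorem timeFreqShift_delta (t ν x : ℝ) :
    timeFreqShift t ν (TemperedDistribution.delta x) =
      character ν (x + t) • TemperedDistribution.delta (x + t) := by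
  ext φ
  change (SchwartzMap.smulLeftCLM ℂ (character ν) φ) (x - -t) = _
  rw [SchwartzMap.smulLeftCLM_apply_apply (hasTemperateGrowth_character ν), sub_neg_eq_add]
  rfl

/-- The `L`-periodic `c`-weighted delta train `∑_m c_{m mod L} δ_{am}`, as a tempered
distribution. -/
def deltaTrain (a : ℝ) {L : ℕ} (c : ZMod L → ℂ) : 𝓢'(ℝ, ℂ) :=
  ∑' m : ℤ, c (m : ZMod L) • TemperedDistribution.delta (a * (m : ℝ))

/-- The series defining the delta train converges in the space of tempered distributions. -/
theorem hasSum_deltaTrain {a : ℝ} (ha : 0 < a) {L : ℕ} [NeZero L] (c : ZMod L → ℂ) :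
    HasSum (fun m : ℤ => c (m : ZMod L) • TemperedDistribution.delta (a * (m : ℝ)))
      (deltaTrain a c) := by
  obtain ⟨B, hB⟩ : ∃ B : ℝ, ∀ r, ‖c r‖ ≤ B := by
    obtain ⟨B, hB⟩ := (Set.finite_range fun r => ‖c r‖).bddAbove
    exact ⟨B, fun r => hB ⟨r, rfl⟩⟩
  have hB0 : 0 ≤ B := (norm_nonneg _).trans (hB 0)
  set w : ℤ → ℝ := fun m => B * (1 / a ^ 2 * (1 / (m : ℝ) ^ 2) + if m = 0 then 1 else 0) with hw
  have hw0 : ∀ m, 0 ≤ w m := fun m => by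
    simp only [hw]
    split_ifs <;> positivity
  have hws : Summable w := by
    refine Summable.mul_left B (Summable.add (Summable.mul_left _ ?_) ?_)
    · exact Real.summable_one_div_int_pow.mpr one_lt_two
    · exact summable_of_ne_finset_zero (s := {0}) (fun m hm => by simp_all)
  set s : Finset (ℕ × ℕ) := {(0, 0), (2, 0)} with hs
  set p : 𝓢(ℝ, ℂ) → ℝ := fun φ => s.sup (schwartzSeminormFamily ℂ ℝ ℂ) φ with hp
  have hbd : ∀ (φ : 𝓢(ℝ, ℂ)) (m : ℤ), ‖c (m : ZMod L) * φ (a * (m : ℝ))‖ ≤ w m * p φ := by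
    intro φ m
    have h0 : SchwartzMap.seminorm ℂ 0 0 φ ≤ p φ :=
      Seminorm.le_def.mp (Finset.le_sup (f := schwartzSeminormFamily ℂ ℝ ℂ)
        (show ((0, 0) : ℕ × ℕ) ∈ s by simp [hs])) φ
    have h2 : SchwartzMap.seminorm ℂ 2 0 φ ≤ p φ :=
      Seminorm.le_def.mp (Finset.le_sup (f := schwartzSeminormFamily ℂ ℝ ℂ)
        (show ((2, 0) : ℕ × ℕ) ∈ s by simp [hs])) φ
    have hp0 : 0 ≤ p φ := apply_nonneg _ _
    have hφ : ‖φ (a * (m : ℝ))‖ ≤ (1 / a ^ 2 * (1 / (m : ℝ) ^ 2) + if m = 0 then 1 else 0) * p φ := by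
      by_cases hm : m = 0
      · have := (SchwartzMap.norm_le_seminorm ℂ φ (a * (m : ℝ))).trans h0
        simpa [hm] using this
      · have h := (SchwartzMap.norm_pow_mul_le_seminorm ℂ φ 2 (a * (m : ℝ))).trans h2
        rw [Real.norm_eq_abs, sq_abs] at h
        have hm' : (m : ℝ) ≠ 0 := by exact_mod_cast hm
        have hpos : 0 < (a * (m : ℝ)) ^ 2 := by positivity
        rw [if_neg hm, add_zero]
        calc ‖φ (a * (m : ℝ))‖ ≤ p φ / (a * (m : ℝ)) ^ 2 := by
              rw [le_div_iff₀ hpos]; linarith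
          _ = _ := by field_simp
    rw [norm_mul, hw]
    calc ‖c (m : ZMod L)‖ * ‖φ (a * (m : ℝ))‖ ≤ B * _ :=
          mul_le_mul (hB _) hφ (norm_nonneg _) hB0
      _ = _ := by ring
  have hsum : ∀ φ : 𝓢(ℝ, ℂ), Summable fun m : ℤ => c (m : ZMod L) * φ (a * (m : ℝ)) := fun φ =>
    Summable.of_norm_bounded (hws.mul_right (p φ)) (hbd φ)
  let T : 𝓢(ℝ, ℂ) →L[ℂ] ℂ := SchwartzMap.mkCLMtoNormedSpace
    (fun φ => ∑' m : ℤ, c (m : ZMod L) * φ (a * (m : ℝ)))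
    (fun φ ψ => by
      rw [← (hsum φ).tsum_add (hsum ψ)]
      exact tsum_congr fun m => by simp [mul_add])
    (fun r φ => by
      simp only [RingHom.id_apply, smul_eq_mul]
      rw [← tsum_mul_left]
      exact tsum_congr fun m => by simp; ring)
    ⟨s, ∑' m, w m, tsum_nonneg hw0, fun φ => by
      rw [← tsum_mul_right]
      exact tsum_of_norm_bounded (hws.mul_right (p φ)).hasSum (hbd φ)⟩
  have hT : HasSum (fun m : ℤ => c (m : ZMod L) • TemperedDistribution.delta (a * (m : ℝ)))
      (ContinuousLinearMap.toPointwiseConvergenceCLM ℂ _ _ _ T : 𝓢'(ℝ, ℂ)) := by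
    refine PointwiseConvergenceCLM.tendsto_iff_forall_tendsto.mpr fun φ => ?_
    have h := (hsum φ).hasSum
    refine h.congr' (Eventually.of_forall fun t => ?_)
    exact (map_sum (PointwiseConvergenceCLM.evalCLM (RingHom.id ℂ) ℂ φ)
      (fun m : ℤ => c (m : ZMod L) • TemperedDistribution.delta (a * (m : ℝ))) t).symm
  exact hT.summable.hasSum

theorem deltaTrain_apply {a : ℝ} (ha : 0 < a) {L : ℕ} [NeZero L] (c : ZMod L → ℂ)
    (φ : 𝓢(ℝ, ℂ)) :
    HasSum (fun m : ℤ => c (m : ZMod L) * φ (a * (m : ℝ))) (deltaTrain a c φ) :=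
  (hasSum_deltaTrain ha c).mapL (PointwiseConvergenceCLM.evalCLM (RingHom.id ℂ) ℂ φ)

/-! ### Stochastic operators -/

/-- A stochastic operator `H f = ∬ η(t,ν) M_ν T_t f dt dν` over the probability space `(Ω, P)`,
given by its stochastic spreading function: a zero-mean second order process `η` indexed by the
time-frequency plane, with sample paths in `L²(ℝ²)`. -/
structure StochasticOperator {Ω : Type*} [MeasurableSpace Ω] (P : Measure Ω) where
  /-- the spreading function `η(t, ν; ω)` -/
  spreading : ℝ × ℝ → Ω → ℂ
  measurable : Measurable (Function.uncurry spreading)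
  memLp_path : ∀ ω, MemLp (fun z => spreading z ω) 2 volume
  memLp_var : ∀ z, MemLp (spreading z) 2 P
  zero_mean : ∀ z, ∫ ω, spreading z ω ∂P = 0

namespace StochasticOperator

variable {Ω : Type*} [MeasurableSpace Ω] {P : Measure Ω}

/-- The autocorrelation `R_η(z; z') = E[η(z) conj (η(z'))]` of the spreading function. -/
def autocorrelation (H : StochasticOperator P) (q : (ℝ × ℝ) × (ℝ × ℝ)) : ℂ :=
  ∫ ω, H.spreading q.1 ω * (starRingEnd ℂ) (H.spreading q.2 ω) ∂P

/-- The integrand `(t,ν) ↦ η(t,ν;ω) ⟨M_ν T_t u, φ⟩` of `⟨H(ω) u, φ⟩`. -/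
def pairingIntegrand (H : StochasticOperator P) (ω : Ω) (u : 𝓢'(ℝ, ℂ)) (φ : 𝓢(ℝ, ℂ))
    (z : ℝ × ℝ) : ℂ :=
  H.spreading z ω * timeFreqShift z.1 z.2 u φ

/-- The random function `f` is the response `H u` of `H` to the tempered distribution `u`:
for almost every `ω`, the path `f(·;ω)` is the square-integrable function that represents the
distribution `H(ω) u = ∬ η(t,ν;ω) M_ν T_t u dt dν`. -/
structure IsResponse (H : StochasticOperator P) (u : 𝓢'(ℝ, ℂ)) (f : ℝ → Ω → ℂ) : Prop where
  measurable : Measurable (Function.uncurry f)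
  memLp : ∀ᵐ ω ∂P, MemLp (fun x => f x ω) 2 volume
  integrable : ∀ᵐ ω ∂P, ∀ φ : 𝓢(ℝ, ℂ), Integrable (H.pairingIntegrand ω u φ) volume
  integral_eq : ∀ᵐ ω ∂P, ∀ φ : 𝓢(ℝ, ℂ),
    ∫ x, f x ω * φ x = ∫ z, H.pairingIntegrand ω u φ z

end StochasticOperator

/-- The stochastic operator Paley-Wiener space `StOPW(U)`, for closed `U ⊆ ℝ⁴`. -/
def StOPW {Ω : Type*} [MeasurableSpace Ω] (P : Measure Ω) (U : Set ((ℝ × ℝ) × (ℝ × ℝ))) :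
    Set (StochasticOperator P) :=
  {H | IsClosed U ∧ tsupport H.autocorrelation ⊆ U}

/-! ### The Zak transform -/

/-- The partial sum `∑_{|n| ≤ N} f(x - anL) exp (2πi aLnν)` of the non-normalized Zak transform. -/
def zakPartialSum (a : ℝ) (L : ℕ) (N : ℕ) (f : ℝ → ℂ) (z : ℝ × ℝ) : ℂ :=
  ∑ n ∈ Finset.Icc (-(N : ℤ)) N, f (z.1 - a * n * L) * character (a * L * n) z.2

/-- `F` is (a version of) the non-normalized Zak transform of `f`: the defining series converges
to `F` in `L²` on every compact set of the plane. -/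
def IsZakTransform (a : ℝ) (L : ℕ) (f : ℝ → ℂ) (F : ℝ × ℝ → ℂ) : Prop :=
  ∀ K : Set (ℝ × ℝ), IsCompact K →
    Tendsto (fun N : ℕ => ∫⁻ z in K, ‖F z - zakPartialSum a L N f z‖ₑ ^ 2) atTop (𝓝 0)

/-- `F` is a jointly measurable version of the pathwise Zak transform of the process `f`. -/
structure IsStochasticZakTransform {Ω : Type*} [MeasurableSpace Ω] (P : Measure Ω)
    (a : ℝ) (L : ℕ) (f : ℝ → Ω → ℂ) (F : ℝ × ℝ → Ω → ℂ) : Prop where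
  measurable : Measurable (Function.uncurry F)
  isZak : ∀ᵐ ω ∂P, IsZakTransform a L (fun x => f x ω) (fun z => F z ω)

/-! ### Rectification, partitions of unity, Gabor matrices, reconstruction -/

/-- `S` is covered by the translates of `[0,a) × [0,b)` by the lattice points
`(a k_j, b n_j)`, `j = 0, …, L-1`. -/
def IsRectified (a b : ℝ) {L : ℕ} (k n : Fin L → ℤ) (S : Set (ℝ × ℝ)) : Prop :=
  S ⊆ ⋃ j, Ico (a * k j) (a * k j + a) ×ˢ Ico (b * n j) (b * n j + b)

/-- `χ` generates an `(a,b,ε)`-partition of unity `{χ(t + ak, ν + bn)}` of the plane. -/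
structure IsPartitionOfUnity (a b ε : ℝ) (χ : ℝ × ℝ → ℂ) : Prop where
  eq_zero : ∀ z : ℝ × ℝ, z ∉ Ioo (-ε) (a + ε) ×ˢ Ioo (-ε) (b + ε) → χ z = 0
  hasSum : ∀ t ν : ℝ, HasSum (fun q : ℤ × ℤ => χ (t + a * q.1, ν + b * q.2)) 1

/-- The `L × L` matrix whose `j`-th column is the finite Gabor atom `M^{n_j} T^{k_j} c`, where
`(M^n T^k c)[p] = exp (2πi n p / L) c[p - k]`. -/
def gaborSubmatrix {L : ℕ} (c : ZMod L → ℂ) (k n : Fin L → ℤ) : Matrix (Fin L) (Fin L) ℂ :=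
  Matrix.of fun p j =>
    Complex.exp (2 * Real.pi * Complex.I * (n j : ℂ) * ((p : ℕ) : ℂ) / (L : ℂ)) *
      c (((p : ℕ) : ZMod L) - (k j : ZMod L))

/-- The reconstruction formula, applied to a function `Z` on the plane (the Zak transform of the
response, or a partial sum of it). -/
def reconstruct (a b : ℝ) {L : ℕ} (k n : Fin L → ℤ) (α : Matrix (Fin L) (Fin L) ℂ)
    (χ Z : ℝ × ℝ → ℂ) (z : ℝ × ℝ) : ℂ :=
  (a * L : ℂ) * ∑ j : Fin L, ∑ p : Fin L,
    α j p *
      Complex.exp (-(2 * Real.pi * Complex.I) *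
        ((z.2 * (z.1 + a * (((p : ℕ) : ℝ) - k j)) - a * b * n j * ((p : ℕ) : ℝ) : ℝ) : ℂ)) *
      χ (z.1 - a * k j, z.2 - b * n j) *
      Z (z.1 + a * (((p : ℕ) : ℝ) - k j), z.2 - b * n j)

/-- The mean-square distance `E |X - Y|²` of two random variables. -/
def meanSquareDist {Ω : Type*} [MeasurableSpace Ω] (P : Measure Ω) (X Y : Ω → ℂ) : ℝ≥0∞ :=
  ∫⁻ ω, ‖X ω - Y ω‖ₑ ^ 2 ∂P

end

/-! Tile the plane by squares of side `s = 1/√L`, so that `a = b = s`. Since `μ(S) < 1`, for large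
`L` the squares whose enlargements meet `S` number at most `ρL` with `ρ < 1`, and their indices are
of size `O(√L)` (`exists_prime_sparse_lattice_cover`). There is thus room to add padding indices and
obtain exactly `L` cells `(k_j, n_j)`.

With `f = H III_c` and `aLb = 1`, Poisson summation in the frequency variable turns the Zak
transform of `f` into a finite weighted periodization of `η`: the values `f(x - aLq)` are the
Fourier coefficients of the `b`-periodic function `zakResponse a b c η (x, ·)`
(`IsSquareSupported.deltaTrainResponse_sub_eq`). Sampling it at `τ + ap`, `0 ≤ p < L`, over one
point `(τ, ξ)` of an enlarged cell gives, up to unimodular factors, `L` linear equations for the `L`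
numbers `η(τ + ak_i, ξ + bn_i)`, with the Gabor matrix of `c` as coefficient matrix. Its inverse
recovers `η` on each cell, and the partition of unity glues the cells together
(`reconstruct_zakResponse`).

A suitable `c` comes from a degeneration. Take `c` to be `x^(v²)` on residues `v`, cut off so that
no difference wraps around modulo `L`. With columns sorted by `k_j`, dual potentials for the
quadratic cost allow row and column rescalings after which the matrix tends, as `x → 0`, to a block
Vandermonde matrix. That limit is invertible, hence so is the Gabor matrix for small `x > 0`. The
argument works for every `L`; primality comes only from the freedom to choose `L` large.

Randomness enters at the end. The diagonal of `R_η` is `E|η|²`, so `η` vanishes almost surely at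
each point off `S`; by Fubini almost every path may be replaced by its restriction to `S`, a
deterministic compactly supported `L²` function. All deterministic constants are uniform in `η`,
which permits integration over `ω` and dominated convergence. -/

/-! ### Invertible Gabor submatrices -/

/-- The dual potential of the quadratic transport cost for a sequence of slopes `κ`. -/
def slopePotential (κ : ℕ → ℕ) (j : ℕ) : ℤ :=
  ∑ i ∈ Finset.range j, ((κ (i + 1) : ℤ) - κ i) * (2 * i + 1)

/-- The amount by which row `p` and column `j` violate complementary slackness. -/
def slopeExcess (κ : ℕ → ℕ) (p j : ℕ) : ℤ :=
  slopePotential κ j - 2 * p * κ j - (slopePotential κ p - 2 * p * κ p)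

/-- The excess is a sum, over `i` between `p` and `j`, of the increments of `κ` times the positive
odd numbers `|2i + 1 - 2p|`, each at least 1. The weight `2i + 1`, midway between `2i` and `2(i +
1)`, is what makes the inequality strict off the level sets of `κ`. -/
theorem abs_sub_le_slopeExcess {κ : ℕ → ℕ} (hκ : Monotone κ) (p j : ℕ) :
    |(κ j : ℤ) - κ p| ≤ slopeExcess κ p j := by
  unfold slopeExcess
  rcases le_total p j with h | h
  · induction j, h using Nat.le_induction with
    | base => simp
    | succ j hj ih =>
      have h1 : (κ j : ℤ) ≤ κ (j + 1) := by exact_mod_cast hκ (Nat.le_succ j)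
      have h2 : (κ p : ℤ) ≤ κ j := by exact_mod_cast hκ hj
      have hj' : (p : ℤ) ≤ j := by exact_mod_cast hj
      rw [abs_of_nonneg (by linarith)] at ih ⊢
      rw [slopePotential, Finset.sum_range_succ, ← slopePotential]
      nlinarith [mul_nonneg (sub_nonneg.mpr h1) (sub_nonneg.mpr hj')]
  · induction p, h using Nat.le_induction with
    | base => simp
    | succ p hp ih =>
      have h1 : (κ p : ℤ) ≤ κ (p + 1) := by exact_mod_cast hκ (Nat.le_succ p)
      have h2 : (κ j : ℤ) ≤ κ p := by exact_mod_cast hκ hp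
      rw [abs_of_nonpos (by linarith)] at ih ⊢
      rw [slopePotential, slopePotential, Finset.sum_range_succ, ← slopePotential, ← slopePotential]
      push_cast
      nlinarith

theorem slopeExcess_eq_zero_iff {κ : ℕ → ℕ} (hκ : Monotone κ) (p j : ℕ) :
    slopeExcess κ p j = 0 ↔ κ j = κ p := by
  have h1 := abs_sub_le_slopeExcess hκ p j
  have h2 := abs_sub_le_slopeExcess hκ j p
  constructor
  · intro h
    rw [h] at h1
    have := abs_nonpos_iff.mp h1
    omega
  · intro h
    have h3 : slopeExcess κ p j + slopeExcess κ j p = 0 := by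
      unfold slopeExcess
      rw [h]
      ring
    have h4 := (abs_nonneg _).trans h1
    have h5 := (abs_nonneg _).trans h2
    omega

theorem exp_two_pi_mul_div_eq_iff {L : ℕ} (hL : L ≠ 0) (m n : ℤ) :
    Complex.exp (2 * Real.pi * Complex.I * m / L) = Complex.exp (2 * Real.pi * Complex.I * n / L) ↔
      (L : ℤ) ∣ m - n := by
  have hL' : (L : ℂ) ≠ 0 := by exact_mod_cast hL
  have hpi : (2 * Real.pi * Complex.I : ℂ) ≠ 0 := Complex.two_pi_I_ne_zero
  rw [Complex.exp_eq_exp_iff_exists_int]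
  constructor
  · rintro ⟨q, hq⟩
    refine ⟨q, ?_⟩
    have h : (2 * Real.pi * Complex.I : ℂ) * (m - n) = (2 * Real.pi * Complex.I) * (L * q) := by
      field_simp at hq
      linear_combination (2 * Real.pi * Complex.I : ℂ) * hq
    exact_mod_cast mul_left_cancel₀ hpi h
  · rintro ⟨q, hq⟩
    refine ⟨q, ?_⟩
    have hq' : (m : ℂ) = n + L * q := by
      have : m = n + L * q := by linarith
      exact_mod_cast this
    rw [hq']
    field_simp

/-- A block Vandermonde matrix, whose blocks are the level sets of a monotone function, is
invertible. -/
theorem det_blockVandermonde_ne_zero {L : ℕ} {κ : ℕ → ℕ} (hκ : Monotone κ) (ζ : Fin L → ℂ)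
    (hζ0 : ∀ i, ζ i ≠ 0)
    (hζ : ∀ i j : Fin L, κ i = κ j → ζ i = ζ j → i = j) :
    (Matrix.of fun p j : Fin L => if κ j = κ p then ζ j ^ (p : ℕ) else 0).det ≠ 0 := by
  classical
  intro hdet
  obtain ⟨v, hv, hv0⟩ := Matrix.exists_vecMul_eq_zero_iff.mpr hdet
  refine hv (funext fun q => ?_)
  -- A left null vector, restricted to one level set, is read as the coefficients of a polynomial.
  -- By monotonicity the level set is an interval starting at `s`, so after removing the factor
  -- `ζ^s` the degree is below the number of distinct roots `ζ j`.
  set I : Finset (Fin L) := Finset.univ.filter fun p => κ p = κ q with hI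
  have hqI : q ∈ I := by simp [hI]
  set s : Fin L := I.min' ⟨q, hqI⟩ with hs
  have hsI : s ∈ I := I.min'_mem _
  have hsle : ∀ p ∈ I, (s : ℕ) ≤ p := fun p hp => I.min'_le p hp
  have hlt : ∀ p ∈ I, (p : ℕ) - s < I.card := by
    intro p hp
    have hsub : Finset.Icc s p ⊆ I := by
      intro r hr
      rw [Finset.mem_Icc] at hr
      simp only [hI, Finset.mem_filter, Finset.mem_univ, true_and] at hp hsI ⊢
      have h1 : κ s ≤ κ r := hκ hr.1
      have h2 : κ r ≤ κ p := hκ hr.2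
      omega
    have := Finset.card_le_card hsub
    rw [Fin.card_Icc] at this
    have := hsle p hp
    omega
  set Q : Polynomial ℂ := ∑ p ∈ I, Polynomial.monomial ((p : ℕ) - s) (v p) with hQ
  have hroot : ∀ j : I, Q.eval (ζ j) = 0 := by
    rintro ⟨j, hj⟩
    have hκj : κ j = κ q := by simpa [hI] using hj
    have h := congrFun hv0 j
    simp only [Matrix.vecMul, dotProduct, Matrix.of_apply, Pi.zero_apply, mul_ite, mul_zero] at h
    rw [← Finset.sum_filter] at h
    have hmul : ζ j ^ (s : ℕ) * Q.eval (ζ j) = 0 := by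
      rw [← h, hQ, Polynomial.eval_finsetSum, Finset.mul_sum]
      refine Finset.sum_congr (by ext p; simp [hI, hκj, eq_comm]) fun p hp => ?_
      have hp' : p ∈ I := by
        simpa [hI, hκj, eq_comm] using hp
      rw [Polynomial.eval_monomial, mul_left_comm, ← pow_add, Nat.add_sub_cancel' (hsle p hp')]
    exact (mul_eq_zero.mp hmul).resolve_left (pow_ne_zero _ (hζ0 j))
  have hdeg : Q.natDegree < Fintype.card I := by
    rw [Fintype.card_coe]
    have hpos : 0 < I.card := Finset.card_pos.mpr ⟨q, hqI⟩
    refine (Polynomial.natDegree_sum_le_of_forall_le I _ (n := I.card - 1) fun p hp => ?_).trans_lt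
      (by omega)
    refine (Polynomial.natDegree_monomial_le _).trans ?_
    have := hlt p hp
    omega
  have hinj : Function.Injective fun j : I => ζ j := by
    rintro ⟨i, hi⟩ ⟨j, hj⟩ hij
    simp only [hI, Finset.mem_filter, Finset.mem_univ, true_and] at hi hj
    exact Subtype.ext (hζ i j (hi.trans hj.symm) hij)
  have hQ0 := Polynomial.eq_zero_of_natDegree_lt_card_of_eval_eq_zero Q hinj hroot hdeg
  have hc : Q.coeff ((q : ℕ) - s) = v q := by
    rw [hQ, Polynomial.finsetSum_coeff, Finset.sum_eq_single q]
    · simp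
    · intro p hp hpq
      rw [Polynomial.coeff_monomial, if_neg]
      intro h
      have := hsle p hp
      have := hsle q hqI
      exact hpq (Fin.ext (by omega))
    · exact fun h => (h hqI).elim
  rw [← hc, hQ0]
  simp

/-- The bounds `hle` and `hge` keep the cutoff of `c` from deleting any entry with `κ p = κ j`;
precisely these entries survive in the limit `x → 0`. -/
theorem exists_gaborSubmatrix_det_ne_zero {L : ℕ} [NeZero L] {κ : ℕ → ℕ} {K : ℕ}
    (hκ : Monotone κ) (hK : ∀ j, κ j < K) (hKL : K ≤ L) (hle : ∀ i < L, κ i ≤ i)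
    (hge : ∀ i < L, i + K ≤ L + κ i) (k n : Fin L → ℤ) (k₀ : ℤ) (hk : ∀ j, k j = κ j + k₀)
    (hn : ∀ i j : Fin L, κ i = κ j → (L : ℤ) ∣ n i - n j → i = j) :
    ∃ c : ZMod L → ℂ, (gaborSubmatrix c k n).det ≠ 0 := by
  classical
  have hL0 : L ≠ 0 := NeZero.ne L
  set ζ : Fin L → ℂ := fun j => Complex.exp (2 * Real.pi * Complex.I * (n j : ℂ) / L) with hζ
  -- The difference `p - κ j` does not wrap around modulo `L` and lies in the support of `c`.
  set ok : ℕ → ℕ → Prop := fun p j => κ j ≤ p ∧ p + K ≤ L + κ j with hok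
  set B : ℝ → Matrix (Fin L) (Fin L) ℂ := fun x => Matrix.of fun p j : Fin L =>
    ζ j ^ (p : ℕ) * (if ok p j then (x : ℂ) ^ (slopeExcess κ p j).toNat else 0) with hB
  have hB0 : (B 0).det ≠ 0 := by
    have h := det_blockVandermonde_ne_zero hκ ζ (fun i => Complex.exp_ne_zero _)
      (fun i j hij h => hn i j hij ((exp_two_pi_mul_div_eq_iff hL0 _ _).mp h))
    convert h using 2
    ext p j
    simp only [hB, Matrix.of_apply]
    by_cases hpj : κ j = κ p
    · have h0 := (slopeExcess_eq_zero_iff hκ p j).mpr hpj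
      have hokpj : ok p j := by
        simp only [hok, hpj]
        exact ⟨hle p p.2, hge p p.2⟩
      rw [if_pos hpj, if_pos hokpj, h0]
      simp
    · have h0 : slopeExcess κ p j ≠ 0 := fun h => hpj ((slopeExcess_eq_zero_iff hκ p j).mp h)
      have h1 := (abs_nonneg _).trans (abs_sub_le_slopeExcess hκ p j)
      have h2 : (slopeExcess κ p j).toNat ≠ 0 := by omega
      rw [if_neg hpj]
      simp [h2]
  have hcont : Continuous fun x => (B x).det := by
    refine Continuous.matrix_det (continuous_matrix fun p j => ?_)
    simp only [hB, Matrix.of_apply]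
    split_ifs <;> fun_prop
  obtain ⟨x, hx, hxdet⟩ : ∃ x : ℝ, 0 < x ∧ (B x).det ≠ 0 := by
    have h1 : ∀ᶠ x in 𝓝[>] (0 : ℝ), (B x).det ≠ 0 :=
      (hcont.continuousAt.eventually_ne hB0).filter_mono nhdsWithin_le_nhds
    obtain ⟨x, h, h'⟩ := (h1.and self_mem_nhdsWithin).exists
    exact ⟨x, h', h⟩
  have hx0 : (x : ℂ) ≠ 0 := by exact_mod_cast hx.ne'
  -- Cutting off the last `K - 1` residues kills every wrapped difference `L + p - κ j`, because `κ
  -- j < K`. Only genuine integer differences contribute.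
  refine ⟨fun r => if (r + (k₀ : ZMod L)).val + K ≤ L then
    (x : ℂ) ^ ((r + (k₀ : ZMod L)).val ^ 2) else 0, ?_⟩
  -- The exponent `(p - κ j)²` is a row term plus `slopeExcess κ p j` plus a column term.
  have hentry : gaborSubmatrix (fun r => if (r + (k₀ : ZMod L)).val + K ≤ L then
      (x : ℂ) ^ ((r + (k₀ : ZMod L)).val ^ 2) else 0) k n =
      Matrix.diagonal (fun p : Fin L =>
        (x : ℂ) ^ ((p : ℤ) ^ 2 + (slopePotential κ p - 2 * p * κ p))) * B x *
      Matrix.diagonal (fun j : Fin L => (x : ℂ) ^ ((κ j : ℤ) ^ 2 - slopePotential κ j)) := by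
    ext p j
    rw [Matrix.mul_diagonal, Matrix.diagonal_mul]
    simp only [hB, gaborSubmatrix, Matrix.of_apply, hζ]
    rw [← Complex.exp_nat_mul]
    have hexp : ((p : ℕ) : ℂ) * (2 * Real.pi * Complex.I * (n j : ℂ) / L) =
        2 * Real.pi * Complex.I * (n j : ℂ) * ((p : ℕ) : ℂ) / L := by ring
    rw [hexp]
    have hr : (((p : ℕ) : ZMod L) - (k j : ZMod L)) + (k₀ : ZMod L) =
        ((p : ℕ) : ZMod L) - ((κ j : ℕ) : ZMod L) := by
      rw [hk]
      push_cast
      ring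
    rw [hr]
    have hp := p.2
    have hκj := hK j
    by_cases hle' : κ j ≤ p
    · have hval : (((p : ℕ) : ZMod L) - ((κ j : ℕ) : ZMod L)).val = p - κ j := by
        rw [← Nat.cast_sub hle', ZMod.val_natCast_of_lt (by omega)]
      rw [hval]
      by_cases hT : (p : ℕ) + K ≤ L + κ j
      · rw [if_pos (by omega), if_pos (show ok p j from ⟨hle', hT⟩)]
        have h1 := (abs_nonneg _).trans (abs_sub_le_slopeExcess hκ p j)
        rw [← zpow_natCast (x : ℂ) (slopeExcess κ p j).toNat, Int.toNat_of_nonneg h1,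
          ← zpow_natCast (x : ℂ) (((p : ℕ) - κ j) ^ 2)]
        rw [mul_left_comm, ← zpow_add₀ hx0, mul_assoc (Complex.exp _), ← zpow_add₀ hx0]
        congr 2
        unfold slopeExcess
        push_cast [Nat.cast_sub hle']
        ring
      · rw [if_neg (by omega), if_neg (fun h => hT h.2)]
        simp
    · have hval : (((p : ℕ) : ZMod L) - ((κ j : ℕ) : ZMod L)).val = L + p - κ j := by
        have : (((p : ℕ) : ZMod L) - ((κ j : ℕ) : ZMod L)) = ((L + p - κ j : ℕ) : ZMod L) := by
          rw [Nat.cast_sub (by omega)]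
          simp
        rw [this, ZMod.val_natCast_of_lt (by omega)]
      rw [hval, if_neg (by omega), if_neg (fun h => hle' h.1)]
      simp
  rw [hentry, Matrix.det_mul, Matrix.det_mul, Matrix.det_diagonal, Matrix.det_diagonal]
  exact mul_ne_zero (mul_ne_zero (Finset.prod_ne_zero_iff.mpr fun p _ => zpow_ne_zero _ hx0) hxdet)
    (Finset.prod_ne_zero_iff.mpr fun p _ => zpow_ne_zero _ hx0)

/-! ### Rectification of compact sets of small area -/

theorem disjoint_lattice_boxes {s : ℝ} (hs : 0 < s) {q q' : ℤ × ℤ} (h : q ≠ q') :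
    Disjoint (Ico (s * q.1) (s * q.1 + s) ×ˢ Ico (s * q.2) (s * q.2 + s))
      (Ico (s * q'.1) (s * q'.1 + s) ×ˢ Ico (s * q'.2) (s * q'.2 + s)) := by
  have key : ∀ (x : ℝ) (m m' : ℤ), x ∈ Ico (s * m) (s * m + s) → x ∈ Ico (s * m') (s * m' + s) →
      m = m' := by
    intro x m m' h1 h2
    have a1 : s * m < s * (m' + 1) := by linarith [h1.1, h2.2]
    have a2 : s * m' < s * (m + 1) := by linarith [h1.2, h2.1]
    have b1 := lt_of_mul_lt_mul_left a1 hs.le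
    have b2 := lt_of_mul_lt_mul_left a2 hs.le
    have c1 : m < m' + 1 := by exact_mod_cast b1
    have c2 : m' < m + 1 := by exact_mod_cast b2
    omega
  rw [Set.disjoint_left]
  intro z hz hz'
  exact h (Prod.ext (key _ _ _ hz.1 hz'.1) (key _ _ _ hz.2 hz'.2))

/-- The selected cells are disjoint, have area `1/L` and lie in the `2s`-neighbourhood of `S`, whose
area is still below 1; hence they number at most `ρL`. The slack `(1 - ρ)L` beats the `O(√L)`
padding `2(2M + 3)` required for the Gabor matrix. Cells are enlarged by `s` on each side to
accommodate partitions of unity with `ε = s`. -/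
theorem exists_prime_sparse_lattice_cover {S : Set (ℝ × ℝ)} (hS : IsCompact S)
    (hμ : volume S < 1) :
    ∃ (L M : ℕ) (s : ℝ) (J : Finset (ℤ × ℤ)), L.Prime ∧ 0 < s ∧ s * s = 1 / (L : ℝ) ∧
      J.card + 2 * (2 * M + 3) ≤ L ∧ (∀ q ∈ J, |q.1| ≤ M ∧ |q.2| ≤ M) ∧
      ∀ z ∈ S, ∀ q : ℤ × ℤ, z ∈ Ioo (s * q.1 - s) (s * q.1 + 2 * s) ×ˢ
        Ioo (s * q.2 - s) (s * q.2 + 2 * s) → q ∈ J := by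
  classical
  obtain ⟨δ, hδ, hδS⟩ : ∃ δ : ℝ, 0 < δ ∧ volume (Metric.cthickening δ S) < 1 := by
    have h1 : ∀ᶠ r in 𝓝[>] (0 : ℝ), volume (Metric.cthickening r S) < 1 :=
      ((tendsto_measure_cthickening_of_isCompact hS).eventually_lt_const hμ).filter_mono
        nhdsWithin_le_nhds
    obtain ⟨δ, h, h'⟩ := (h1.and self_mem_nhdsWithin).exists
    exact ⟨δ, h', h⟩
  set ρ : ℝ := (volume (Metric.cthickening δ S)).toReal with hρ
  have hρ1 : ρ < 1 := by
    rw [hρ, ← ENNReal.toReal_one]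
    exact (ENNReal.toReal_lt_toReal hδS.ne_top ENNReal.one_ne_top).mpr hδS
  obtain ⟨R, hR0, hR⟩ : ∃ R : ℝ, 0 ≤ R ∧ ∀ z ∈ S, |z.1| ≤ R ∧ |z.2| ≤ R := by
    obtain ⟨R, hR⟩ := hS.isBounded.exists_norm_le
    refine ⟨max R 0, le_max_right _ _, fun z hz => ?_⟩
    have := (hR z hz).trans (le_max_left R 0)
    rw [Prod.norm_def] at this
    exact max_le_iff.mp this
  -- For `y = √L ≥ Y` the three summands give `y ≥ 1`, then `(1 - ρ)y² ≥ 4Ry + 18`, which is the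
  -- cardinality bound with `M ≤ Ry + 3`, and finally `2s ≤ δ`.
  set Y : ℝ := 1 + (4 * R + 18) / (1 - ρ) + 2 / δ with hY
  have h1ρ : 0 < 1 - ρ := by linarith
  have hY1 : 0 ≤ (4 * R + 18) / (1 - ρ) := by positivity
  have hY2 : 0 ≤ 2 / δ := by positivity
  obtain ⟨L, hLY, hL⟩ := Nat.exists_infinite_primes ⌈Y ^ 2⌉₊
  have hLY' : Y ^ 2 ≤ L := (Nat.le_ceil _).trans (by exact_mod_cast hLY)
  set y : ℝ := √(L : ℝ) with hy
  have hyY : Y ≤ y := Real.le_sqrt_of_sq_le hLY'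
  have hyy : y * y = L := Real.mul_self_sqrt (Nat.cast_nonneg L)
  have hy1 : 1 ≤ y := by linarith
  have hy0 : 0 < y := by linarith
  set s : ℝ := 1 / y with hs
  have hs0 : 0 < s := by positivity
  have hsy : s * y = 1 := by rw [hs]; field_simp
  have hsδ : 2 * s ≤ δ := by
    have h : 2 / δ ≤ y := by linarith
    rw [div_le_iff₀ hδ] at h
    rw [hs]
    rw [mul_one_div, div_le_iff₀ hy0]
    linarith
  have hcoef : ρ * (y * y) + 2 * (2 * (R * y + 3) + 3) ≤ y * y := by
    have h : (4 * R + 18) / (1 - ρ) ≤ y := by linarith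
    rw [div_le_iff₀ h1ρ] at h
    nlinarith
  set M : ℕ := ⌈R * y⌉₊ + 2 with hM
  have hMle : (M : ℝ) ≤ R * y + 3 := by
    have := (Nat.ceil_lt_add_one (mul_nonneg hR0 hy0.le)).le
    rw [hM]
    push_cast
    linarith
  have hMge : R * y + 2 ≤ M := by
    have := Nat.le_ceil (R * y)
    rw [hM]
    push_cast
    linarith
  set I : Finset (ℤ × ℤ) := Finset.Icc (-(M : ℤ)) M ×ˢ Finset.Icc (-(M : ℤ)) M with hI
  set J : Finset (ℤ × ℤ) := I.filter fun q => ∃ z ∈ S, z ∈ Ioo (s * q.1 - s) (s * q.1 + 2 * s) ×ˢ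
        Ioo (s * q.2 - s) (s * q.2 + 2 * s) with hJ
  refine ⟨L, M, s, J, hL, hs0, ?_, ?_, ?_, ?_⟩
  · rw [← hyy, hs]
    field_simp
  · set box : ℤ × ℤ → Set (ℝ × ℝ) := fun q =>
      Ico (s * q.1) (s * q.1 + s) ×ˢ Ico (s * q.2) (s * q.2 + s) with hbox
    have hvol : ∀ q, volume (box q) = ENNReal.ofReal (s * s) := by
      intro q
      rw [hbox, Measure.volume_eq_prod, Measure.prod_prod, Real.volume_Ico, Real.volume_Ico,
        ENNReal.ofReal_mul hs0.le]
      simp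
    have hsub : (⋃ q ∈ J, box q) ⊆ Metric.cthickening δ S := by
      intro w hw
      simp only [mem_iUnion, exists_prop] at hw
      obtain ⟨q, hq, hwq⟩ := hw
      obtain ⟨z, hz, hzq⟩ := (Finset.mem_filter.mp hq).2
      refine Metric.mem_cthickening_of_dist_le w z δ S hz ?_
      obtain ⟨⟨a1, a2⟩, a3, a4⟩ := hwq
      obtain ⟨⟨b1, b2⟩, b3, b4⟩ := hzq
      rw [Prod.dist_eq, Real.dist_eq, Real.dist_eq]
      exact max_le (abs_le.mpr ⟨by linarith, by linarith⟩) (abs_le.mpr ⟨by linarith, by linarith⟩)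
    have hsum : (J.card : ℝ≥0∞) * ENNReal.ofReal (s * s) ≤ ENNReal.ofReal ρ := by
      rw [hρ, ENNReal.ofReal_toReal hδS.ne_top]
      refine le_trans (le_of_eq ?_) (measure_mono hsub)
      rw [measure_biUnion_finset (fun q _ q' _ h => disjoint_lattice_boxes hs0 h)
        (fun q _ => measurableSet_Ico.prod measurableSet_Ico)]
      rw [Finset.sum_congr rfl fun q _ => hvol q]
      simp
    have hcard : (J.card : ℝ) * (s * s) ≤ ρ := by
      rw [← ENNReal.ofReal_natCast, ← ENNReal.ofReal_mul (Nat.cast_nonneg _)] at hsum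
      exact (ENNReal.ofReal_le_ofReal_iff ENNReal.toReal_nonneg).mp hsum
    have hcard' : (J.card : ℝ) ≤ ρ * (y * y) := by
      have := mul_le_mul_of_nonneg_right hcard (mul_pos hy0 hy0).le
      calc (J.card : ℝ) = J.card * (s * s) * (y * y) := by
            rw [show (J.card : ℝ) * (s * s) * (y * y) = J.card * ((s * y) * (s * y)) by ring, hsy]
            ring
        _ ≤ _ := this
    have : (J.card : ℝ) + 2 * (2 * M + 3) ≤ L := by rw [← hyy]; linarith
    exact_mod_cast this
  · intro q hq
    have h := (Finset.mem_filter.mp hq).1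
    simp only [hI, Finset.mem_product, Finset.mem_Icc] at h
    exact ⟨abs_le.mpr h.1, abs_le.mpr h.2⟩
  · intro z hz q hq
    refine Finset.mem_filter.mpr ⟨?_, z, hz, hq⟩
    have key : ∀ (x : ℝ) (m : ℤ), |x| ≤ R → x ∈ Ioo (s * m - s) (s * m + 2 * s) →
        m ∈ Finset.Icc (-(M : ℤ)) M := by
      intro x m hx hm
      have hxy : |x| * y ≤ R * y := mul_le_mul_of_nonneg_right hx hy0.le
      obtain ⟨c1, c2⟩ := abs_le.mp hx
      have e1 : (m : ℝ) - 1 < x * y := by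
        have := mul_lt_mul_of_pos_right hm.1 hy0
        have h : (s * m - s) * y = m - 1 := by linear_combination ((m : ℝ) - 1) * hsy
        linarith
      have e2 : x * y < m + 2 := by
        have := mul_lt_mul_of_pos_right hm.2 hy0
        have h : (s * m + 2 * s) * y = m + 2 := by linear_combination ((m : ℝ) + 2) * hsy
        linarith
      have e3 : x * y ≤ R * y := mul_le_mul_of_nonneg_right c2 hy0.le
      have e4 : -R * y ≤ x * y := mul_le_mul_of_nonneg_right c1 hy0.le
      rw [Finset.mem_Icc]
      constructor
      · have : (-(M : ℝ)) ≤ m := by linarith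
        exact_mod_cast this
      · have : (m : ℝ) ≤ M := by linarith
        exact_mod_cast this
    simp only [hI, Finset.mem_product]
    exact ⟨key _ _ (hR z hz).1 hq.1, key _ _ (hR z hz).2 hq.2⟩

/-- Lexicographic order makes the first coordinates of `J` monotone. With `K = 2M + 3`, they are
shifted into `[1, K - 2]` and preceded by `K` padding columns of slope `0`, which forces `κ i ≤ i`.
The at least `K` columns that follow have slope `K - 1`, which forces `i + K ≤ L + κ i`. Within each
slope the second coordinates are distinct and differ by less than `L`, hence are distinct modulo
`L`. -/
theorem exists_lattice_enumeration_gaborSubmatrix_det_ne_zero {L M : ℕ} [NeZero L]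
    (J : Finset (ℤ × ℤ)) (hcard : J.card + 2 * (2 * M + 3) ≤ L)
    (hJ : ∀ q ∈ J, |q.1| ≤ M ∧ |q.2| ≤ M) :
    ∃ (k n : Fin L → ℤ) (c : ZMod L → ℂ), (gaborSubmatrix c k n).det ≠ 0 ∧
      (∀ q ∈ J, ∃ j, (k j, n j) = q) ∧ Function.Injective fun j => (k j, n j) := by
  classical
  set N := J.card with hN
  set K := 2 * M + 3 with hKdef
  set J' : Finset (ℤ ×ₗ ℤ) := J.map toLex.toEmbedding with hJ'
  have hJ'c : J'.card = N := by rw [hJ', Finset.card_map]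
  set e : Fin N ↪o (ℤ ×ₗ ℤ) := J'.orderEmbOfFin hJ'c with he
  set u : Fin N → ℤ × ℤ := fun i => ofLex (e i) with hu
  have huJ : ∀ i, u i ∈ J := by
    intro i
    have h : e i ∈ J' := Finset.orderEmbOfFin_mem J' hJ'c i
    rw [hJ', Finset.mem_map] at h
    obtain ⟨q, hq, hqe⟩ := h
    simp only [hu, ← hqe]
    exact hq
  have husurj : ∀ q ∈ J, ∃ i, u i = q := by
    intro q hq
    have h : toLex q ∈ Set.range e := by
      rw [he, Finset.range_orderEmbOfFin]
      simpa [hJ'] using hq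
    obtain ⟨i, hi⟩ := h
    exact ⟨i, by simp only [hu, hi, ofLex_toLex]⟩
  have huinj : ∀ i j, u i = u j → i = j := fun i j h => e.injective (ofLex.injective h)
  have humono : ∀ i j, i ≤ j → (u i).1 ≤ (u j).1 := by
    intro i j hij
    have h := e.monotone hij
    rw [Prod.Lex.le_iff] at h
    rcases h with h | h
    · exact h.le
    · exact h.1.le
  set κ : ℕ → ℕ := fun i => if i < K then 0 else
    if h : i - K < N then ((u ⟨i - K, h⟩).1 + M + 1).toNat else K - 1 with hκ
  set ν : ℕ → ℤ := fun i => if i < K then i else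
    if h : i - K < N then (u ⟨i - K, h⟩).2 else (i : ℤ) - K - N with hν
  have hb : ∀ i, -(M : ℤ) ≤ (u i).1 ∧ (u i).1 ≤ M ∧ -(M : ℤ) ≤ (u i).2 ∧ (u i).2 ≤ M := by
    intro i
    have := hJ _ (huJ i)
    exact ⟨(abs_le.mp this.1).1, (abs_le.mp this.1).2, (abs_le.mp this.2).1, (abs_le.mp this.2).2⟩
  have hcases : ∀ i, (i < K ∧ κ i = 0 ∧ ν i = i) ∨
      (∃ h : i - K < N, K ≤ i ∧ (κ i : ℤ) = (u ⟨i - K, h⟩).1 + M + 1 ∧ ν i = (u ⟨i - K, h⟩).2) ∨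
      (K + N ≤ i ∧ κ i = K - 1 ∧ ν i = (i : ℤ) - K - N) := by
    intro i
    by_cases h1 : i < K
    · left; simp [hκ, hν, h1]
    · by_cases h2 : i - K < N
      · right; left
        refine ⟨h2, by omega, ?_, by simp [hν, h1, h2]⟩
        have := hb ⟨i - K, h2⟩
        simp only [hκ, h1, h2, dif_pos, if_false]
        omega
      · right; right
        refine ⟨by omega, by simp [hκ, h1, h2], by simp [hν, h1, h2]⟩
  have hmono : Monotone κ := by
    intro i j hij
    rcases hcases i with ⟨h1, h2, h3⟩ | ⟨h, h1, h2, h3⟩ | ⟨h1, h2, h3⟩ <;>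
    rcases hcases j with ⟨h1', h2', h3'⟩ | ⟨h', h1', h2', h3'⟩ | ⟨h1', h2', h3'⟩
    any_goals omega
    · have := humono ⟨i - K, h⟩ ⟨j - K, h'⟩ (Fin.mk_le_mk.mpr (by omega))
      omega
    · have := hb ⟨i - K, h⟩
      omega
  have hdist : ∀ i j, i < L → j < L → κ i = κ j → (L : ℤ) ∣ ν i - ν j → i = j := by
    have hsmall : ∀ d : ℤ, |d| < L → (L : ℤ) ∣ d → d = 0 := fun d h1 h2 =>
      Int.eq_zero_of_abs_lt_dvd h2 h1
    intro i j hi hj hκij hdvd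
    rcases hcases i with ⟨h1, h2, h3⟩ | ⟨h, h1, h2, h3⟩ | ⟨h1, h2, h3⟩ <;>
    rcases hcases j with ⟨h1', h2', h3'⟩ | ⟨h', h1', h2', h3'⟩ | ⟨h1', h2', h3'⟩
    · have := hsmall _ (by rw [h3, h3', abs_lt]; constructor <;> omega) hdvd
      omega
    · have := hb ⟨j - K, h'⟩
      omega
    · omega
    · have := hb ⟨i - K, h⟩
      omega
    · have b1 := hb ⟨i - K, h⟩
      have b2 := hb ⟨j - K, h'⟩
      have := hsmall _ (by rw [h3, h3', abs_lt]; constructor <;> omega) hdvd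
      have h4 := huinj _ _ (Prod.ext (show (u ⟨i - K, h⟩).1 = (u ⟨j - K, h'⟩).1 by omega)
        (show (u ⟨i - K, h⟩).2 = (u ⟨j - K, h'⟩).2 by omega))
      have := Fin.mk.inj_iff.mp h4
      omega
    · have := hb ⟨i - K, h⟩
      omega
    · omega
    · have := hb ⟨j - K, h'⟩
      omega
    · have := hsmall _ (by rw [h3, h3', abs_lt]; constructor <;> omega) hdvd
      omega
  obtain ⟨c, hc⟩ := exists_gaborSubmatrix_det_ne_zero (L := L) (κ := κ) (K := K) hmono
    (fun j => by
      rcases hcases j with ⟨h1, h2, h3⟩ | ⟨h, h1, h2, h3⟩ | ⟨h1, h2, h3⟩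
      · omega
      · have := hb ⟨j - K, h⟩
        omega
      · omega)
    (by omega)
    (fun i hi => by
      rcases hcases i with ⟨h1, h2, h3⟩ | ⟨h, h1, h2, h3⟩ | ⟨h1, h2, h3⟩
      · omega
      · have := hb ⟨i - K, h⟩
        omega
      · omega)
    (fun i hi => by
      rcases hcases i with ⟨h1, h2, h3⟩ | ⟨h, h1, h2, h3⟩ | ⟨h1, h2, h3⟩
      · omega
      · have := hb ⟨i - K, h⟩
        omega
      · omega)
    -- Undoing the shift by `M + 1` restores the original first coordinates on `J`.
    (fun j => (κ j : ℤ) + (-(M + 1 : ℤ))) (fun j => ν j) (-(M + 1 : ℤ)) (fun _ => rfl)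
    (fun i j h h' => Fin.ext (hdist i j i.2 j.2 h h'))
  refine ⟨_, _, c, hc, ?_, ?_⟩
  · intro q hq
    obtain ⟨i, rfl⟩ := husurj q hq
    refine ⟨⟨K + i, by omega⟩, ?_⟩
    have hi := i.2
    rcases hcases (K + i) with ⟨h1, h2, h3⟩ | ⟨h, h1, h2, h3⟩ | ⟨h1, h2, h3⟩
    · omega
    · have h4 : (⟨K + i - K, h⟩ : Fin N) = i := Fin.ext (by simp)
      rw [h4] at h2 h3
      exact Prod.ext (by simp only [h2]; ring) h3
    · omega
  · intro i j hij
    have h1 : (κ i : ℤ) + (-(M + 1 : ℤ)) = (κ j : ℤ) + (-(M + 1 : ℤ)) := congrArg Prod.fst hij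
    have h2 : ν i = ν j := congrArg Prod.snd hij
    refine Fin.ext (hdist i j i.2 j.2 (by omega) ?_)
    rw [h2, sub_self]
    exact dvd_zero _

/-! ### Square summable Fourier series on an interval -/

theorem character_eq_fourier {b β : ℝ} (h : β * b = 1) (q : ℤ) (ξ : ℝ) :
    character (β * q) ξ = fourier q (ξ : AddCircle b) := by
  have hb : (b : ℂ) ≠ 0 := by
    rintro hb
    have : b = 0 := by exact_mod_cast hb
    simp [this] at h
  have h' : (β : ℂ) * b = 1 := by exact_mod_cast h
  rw [fourier_coe_apply, character]
  congr 1
  push_cast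
  rw [eq_div_iff hb]
  linear_combination 2 * Real.pi * Complex.I * q * ξ * h'

/-- The remainder is orthogonal to the partial sum. This supplies the dominating function for the
errors of the Zak partial sums. -/
theorem Orthonormal.norm_sub_sum_inner_le {E ι : Type*} [NormedAddCommGroup E]
    [InnerProductSpace ℂ E] {v : ι → E} (hv : Orthonormal ℂ v) (x : E) (s : Finset ι) :
    ‖x - ∑ i ∈ s, inner ℂ (v i) x • v i‖ ≤ ‖x‖ := by
  classical
  set y := ∑ i ∈ s, inner ℂ (v i) x • v i with hy
  have horth : inner ℂ (x - y) y = 0 := by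
    rw [hy, inner_sum]
    refine Finset.sum_eq_zero fun i hi => ?_
    rw [inner_smul_right, inner_sub_left, ← inner_conj_symm (𝕜 := ℂ) _ (v i),
      ← inner_conj_symm (𝕜 := ℂ) (∑ _ ∈ s, _) (v i), hv.inner_right_sum _ hi, sub_self, mul_zero]
  have h := norm_add_sq_eq_norm_sq_add_norm_sq_of_inner_eq_zero (x - y) y horth
  rw [sub_add_cancel] at h
  nlinarith [norm_nonneg (x - y), norm_nonneg x, norm_nonneg y]

section FourierInterval

variable {b β : ℝ} {g : ℝ → ℂ}

theorem lintegral_Ioc_eq_mul_enorm_sq [hb : Fact (0 < b)]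
    (V : Lp ℂ 2 (AddCircle.haarAddCircle (T := b))) {U : AddCircle b → ℂ}
    (h : V =ᵐ[AddCircle.haarAddCircle] U) :
    ∫⁻ ξ in Ioc 0 b, ‖U ξ‖ₑ ^ 2 = ENNReal.ofReal b * ‖V‖ₑ ^ 2 := by
  have h1 := AddCircle.lintegral_preimage b 0 (fun x => ‖U x‖ₑ ^ 2)
  rw [zero_add] at h1
  rw [h1, AddCircle.volume_eq_smul_haarAddCircle, lintegral_smul_measure, smul_eq_mul,
    Lp.enorm_def]
  congr 1
  rw [eLpNorm_congr_ae h]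
  have h2 := eLpNorm_nnreal_pow_eq_lintegral (f := U) (μ := AddCircle.haarAddCircle (T := b))
    (p := 2) two_ne_zero
  simp only [NNReal.coe_ofNat, ENNReal.coe_ofNat, ENNReal.rpow_ofNat] at h2
  exact h2.symm

/-- Three facts are needed on each fiber of the Zak transform: convergence, a bound uniform in `N`
for dominated convergence, and Bessel's inequality for the square integrability of the response. -/
theorem exists_fourier_partialSum_L2 (hb : 0 < b) (hβ : β * b = 1)
    (hg : MemLp g 2 (volume.restrict (Ioc 0 b))) {c : ℤ → ℂ}
    (hc : ∀ q : ℤ, c q = β * ∫ ξ in Ioc 0 b, g ξ * character (-(β * q)) ξ) :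
    Tendsto (fun N : ℕ => ∫⁻ ξ in Ioc 0 b, ‖g ξ - ∑ q ∈ Finset.Icc (-(N : ℤ)) N,
        c q * character (β * q) ξ‖ₑ ^ 2) atTop (𝓝 0) ∧
      (∀ N : ℕ, ∫⁻ ξ in Ioc 0 b, ‖g ξ - ∑ q ∈ Finset.Icc (-(N : ℤ)) N,
        c q * character (β * q) ξ‖ₑ ^ 2 ≤ ∫⁻ ξ in Ioc 0 b, ‖g ξ‖ₑ ^ 2) ∧
      ∑' q, ‖c q‖ₑ ^ 2 ≤ ENNReal.ofReal β * ∫⁻ ξ in Ioc 0 b, ‖g ξ‖ₑ ^ 2 := by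
  have : Fact (0 < b) := ⟨hb⟩
  have hβ0 : β = 1 / b := by rw [eq_div_iff hb.ne']; exact hβ
  have hβpos : 0 < β := by rw [hβ0]; positivity
  have hg' : MemLp g 2 (volume.restrict (Ioc 0 (0 + b))) := by rwa [zero_add]
  have hG : MemLp (AddCircle.liftIoc b 0 g) 2 AddCircle.haarAddCircle :=
    hg'.memLp_liftIoc.haarAddCircle
  set V : Lp ℂ 2 (AddCircle.haarAddCircle (T := b)) := hG.toLp with hV
  have hcoef : ∀ q, fourierCoeff (V : AddCircle b → ℂ) q = c q := by
    intro q
    rw [fourierCoeff_congr_ae hG.coeFn_toLp, fourierCoeff_liftIoc_eq, fourierCoeffOn_eq_integral,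
      hc, intervalIntegral.integral_of_le (by linarith), zero_add, sub_zero, ← hβ0,
      Complex.real_smul]
    congr 2
    ext ξ
    rw [smul_eq_mul, mul_comm, ← character_eq_fourier hβ]
    push_cast
    rw [mul_neg]
  set P : Finset ℤ → Lp ℂ 2 (AddCircle.haarAddCircle (T := b)) := fun s =>
    ∑ q ∈ s, c q • fourierLp 2 q with hP
  have hPV : ∀ s, ((V - P s : Lp ℂ 2 (AddCircle.haarAddCircle (T := b))) : AddCircle b → ℂ)
      =ᵐ[AddCircle.haarAddCircle] fun x => AddCircle.liftIoc b 0 g x - ∑ q ∈ s, c q * fourier q x := by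
    intro s
    have h1 : (P s : AddCircle b → ℂ) =ᵐ[AddCircle.haarAddCircle] fun x =>
        ∑ q ∈ s, c q * fourier q x := by
      have h2 : ∀ᵐ x ∂(AddCircle.haarAddCircle (T := b)), ∀ q : ℤ,
          (c q • fourierLp (T := b) 2 q : Lp ℂ 2 (AddCircle.haarAddCircle (T := b))) x =
            c q * fourier q x := by
        rw [ae_all_iff]
        intro q
        filter_upwards [Lp.coeFn_smul (c q) (fourierLp (T := b) 2 q), coeFn_fourierLp (T := b) 2 q]
          with x hx1 hx2
        rw [hx1, Pi.smul_apply, hx2, smul_eq_mul]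
      filter_upwards [Lp.coeFn_finsetSum s fun q => c q • fourierLp (T := b) 2 q, h2] with x hx hx2
      rw [hP]
      simp only
      rw [hx]
      simp [hx2]
    filter_upwards [Lp.coeFn_sub V (P s), h1, hG.coeFn_toLp] with x hx hx1 hx2
    rw [hx, Pi.sub_apply, hx1, hV, hx2]
  have hint : ∀ s : Finset ℤ, ∫⁻ ξ in Ioc 0 b, ‖g ξ - ∑ q ∈ s, c q * character (β * q) ξ‖ₑ ^ 2 =
      ENNReal.ofReal b * ‖V - P s‖ₑ ^ 2 := by
    intro s
    rw [← lintegral_Ioc_eq_mul_enorm_sq _ (hPV s)]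
    refine setLIntegral_congr_fun measurableSet_Ioc fun ξ hξ => ?_
    simp only [character_eq_fourier hβ]
    rw [AddCircle.liftIoc_coe_apply (by rwa [zero_add])]
  have hint0 : ∫⁻ ξ in Ioc 0 b, ‖g ξ‖ₑ ^ 2 = ENNReal.ofReal b * ‖V‖ₑ ^ 2 := by
    have := hint ∅
    simpa [hP] using this
  have hinner : ∀ q, inner ℂ (fourierLp (T := b) 2 q) V = c q := by
    intro q
    rw [← hcoef, ← fourierBasis_repr, HilbertBasis.repr_apply_apply, coe_fourierBasis]
  have hsum : HasSum (fun q => c q • fourierLp (T := b) 2 q) V := by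
    have := hasSum_fourier_series_L2 V
    simpa only [hcoef] using this
  refine ⟨?_, fun N => ?_, ?_⟩
  · have h1 : Tendsto (fun N : ℕ => V - P (Finset.Icc (-(N : ℤ)) N)) atTop (𝓝 (V - V)) :=
      tendsto_const_nhds.sub (hsum.comp (Finset.tendsto_Icc_neg (R := ℤ)))
    rw [sub_self] at h1
    simp only [hint]
    have h2 : Tendsto (fun N : ℕ => ‖V - P (Finset.Icc (-(N : ℤ)) N)‖ₑ) atTop (𝓝 0) := by
      have := h1.enorm
      rwa [enorm_zero] at this
    have h3 := ENNReal.Tendsto.const_mul (a := ENNReal.ofReal b) (ENNReal.Tendsto.pow (n := 2) h2)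
      (Or.inr ENNReal.ofReal_ne_top)
    simpa using h3
  · rw [hint, hint0]
    gcongr
    have h := (orthonormal_fourier (T := b)).norm_sub_sum_inner_le V (Finset.Icc (-(N : ℤ)) N)
    simp only [hinner] at h
    rw [← ofReal_norm, ← ofReal_norm]
    exact ENNReal.ofReal_le_ofReal h
  · rw [hint0, ← mul_assoc, ← ENNReal.ofReal_mul hβpos.le, hβ, ENNReal.ofReal_one, one_mul]
    rw [ENNReal.tsum_eq_iSup_sum]
    refine iSup_le fun s => ?_
    have h := (orthonormal_fourier (T := b)).sum_inner_products_le V (s := s)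
    simp only [hinner] at h
    simp only [← ofReal_norm, ← ENNReal.ofReal_pow (norm_nonneg _)]
    rw [← ENNReal.ofReal_sum_of_nonneg fun q _ => sq_nonneg _]
    exact ENNReal.ofReal_le_ofReal h

end FourierInterval

/-! ### Unfolding integrals over the line -/

theorem map_add_right_restrict_Ioc (t T : ℝ) :
    (volume.restrict (Ioc 0 T)).map (fun x => x + t) = volume.restrict (Ioc t (t + T)) := by
  have h := ((measurePreserving_add_right (volume : Measure ℝ) t).restrict_preimage
    (measurableSet_Ioc (a := t) (b := t + T))).map_eq
  have h' : (fun x => x + t) ⁻¹' Ioc t (t + T) = Ioc 0 T := by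
    rw [preimage_add_const_Ioc, sub_self, add_sub_cancel_left]
  rwa [h'] at h

theorem lintegral_eq_tsum_Ioc {T : ℝ} (hT : 0 < T) (h : ℝ → ℝ≥0∞) :
    ∫⁻ x, h x = ∑' q : ℤ, ∫⁻ x in Ioc 0 T, h (x + T * q) := by
  have hU := iUnion_Ioc_zsmul hT
  have hd : Pairwise (Function.onFun Disjoint fun n : ℤ => Ioc (n • T) ((n + 1) • T)) :=
    pairwise_disjoint_Ioc_zsmul T
  rw [← setLIntegral_univ, ← hU, lintegral_iUnion (fun _ => measurableSet_Ioc) hd]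
  refine tsum_congr fun q => ?_
  have e : ((q + 1) • T : ℝ) = T * q + T := by simp; ring
  have e' : (q • T : ℝ) = T * q := by simp; ring
  rw [e, e', ← map_add_right_restrict_Ioc,
    (measurableEmbedding_addRight (T * (q : ℝ))).lintegral_map]

theorem hasSum_integral_Ioc {T : ℝ} (hT : 0 < T) {g : ℝ → ℂ} (hg : Integrable g) :
    HasSum (fun q : ℤ => ∫ x in Ioc 0 T, g (x + T * q)) (∫ x, g x) := by
  have hU := iUnion_Ioc_zsmul hT
  have hd : Pairwise (Function.onFun Disjoint fun n : ℤ => Ioc (n • T) ((n + 1) • T)) :=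
    pairwise_disjoint_Ioc_zsmul T
  have h := hasSum_integral_iUnion (μ := volume) (f := g) (fun _ => measurableSet_Ioc) hd
    hg.integrableOn
  rw [hU, setIntegral_univ] at h
  refine (congrArg (fun u : ℤ → ℂ => HasSum u (∫ x, g x)) (funext fun q => ?_)).mp h
  have e : ((q + 1) • T : ℝ) = T * q + T := by simp; ring
  have e' : (q • T : ℝ) = T * q := by simp; ring
  rw [e, e', ← map_add_right_restrict_Ioc,
    (measurableEmbedding_addRight (T * (q : ℝ))).integral_map]

theorem exists_finset_lt_abs_sub_mul {a : ℝ} (ha : 0 < a) (R X : ℝ) :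
    ∃ A : Finset ℤ, ∀ m ∉ A, ∀ x : ℝ, |x| ≤ X → R < |x - a * m| := by
  refine ⟨Finset.Icc (-⌈(R + X) / a⌉) ⌈(R + X) / a⌉, fun m hm x hx => ?_⟩
  have h1 : (R + X) / a < |(m : ℝ)| := by
    refine (Int.le_ceil _).trans_lt ?_
    have h : ⌈(R + X) / a⌉ < |m| := by
      by_contra! hcon
      exact hm (Finset.mem_Icc.mpr (abs_le.mp hcon))
    exact_mod_cast h
  rw [div_lt_iff₀ ha] at h1
  have h2 : |a * m| = |(m : ℝ)| * a := by rw [abs_mul, abs_of_pos ha, mul_comm]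
  have h3 : |a * m| ≤ |x - a * m| + |x| := by
    have := abs_sub (x - a * m) x
    rwa [sub_sub_cancel_left, abs_neg] at this
  linarith

theorem exists_finset_lt_abs_add_mul {a : ℝ} (ha : 0 < a) (R X : ℝ) :
    ∃ A : Finset ℤ, ∀ m ∉ A, ∀ x : ℝ, |x| ≤ X → R < |x + a * m| := by
  obtain ⟨A, hA⟩ := exists_finset_lt_abs_sub_mul ha R X
  refine ⟨A, fun m hm x hx => ?_⟩
  have := hA m hm (-x) (by rwa [abs_neg])
  rwa [← abs_neg, neg_sub, sub_neg_eq_add, add_comm] at this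

theorem exists_lintegral_periodic_le {b : ℝ} (hb : 0 < b) (X : ℝ) :
    ∃ n : ℕ, ∀ h : ℝ → ℝ≥0∞, Function.Periodic h b →
      ∫⁻ x in Icc (-X) X, h x ≤ n * ∫⁻ x in Ioc 0 b, h x := by
  obtain ⟨A, hA⟩ := exists_finset_lt_abs_add_mul hb X b
  refine ⟨A.card, fun h hh => ?_⟩
  rw [← lintegral_indicator measurableSet_Icc, lintegral_eq_tsum_Ioc hb, tsum_eq_sum (s := A)]
  · rw [← nsmul_eq_mul]
    refine Finset.sum_le_card_nsmul _ _ _ fun q _ => lintegral_mono fun x => ?_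
    refine (indicator_le_self _ h _).trans (le_of_eq ?_)
    have := hh.int_mul q x
    rwa [mul_comm] at this
  · intro q hq
    refine (setLIntegral_congr_fun (g := fun _ => 0) measurableSet_Ioc fun x hx => ?_).trans
      lintegral_zero
    have := hA q hq x (abs_le.mpr ⟨by linarith [hx.1], hx.2⟩)
    exact indicator_of_notMem (s := Icc (-X) X) (fun hx' => this.not_ge (abs_le.mpr hx')) h

theorem enorm_sum_sq_le {ι : Type*} (s : Finset ι) (u : ι → ℂ) :
    ‖∑ i ∈ s, u i‖ₑ ^ 2 ≤ s.card * ∑ i ∈ s, ‖u i‖ₑ ^ 2 := by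
  simp only [← ofReal_norm, ← ENNReal.ofReal_pow (norm_nonneg _)]
  rw [← ENNReal.ofReal_sum_of_nonneg fun i _ => sq_nonneg _, ← ENNReal.ofReal_natCast,
    ← ENNReal.ofReal_mul (Nat.cast_nonneg _)]
  refine ENNReal.ofReal_le_ofReal ?_
  calc ‖∑ i ∈ s, u i‖ ^ 2 ≤ (∑ i ∈ s, ‖u i‖) ^ 2 := by
        gcongr
        exact norm_sum_le _ _
    _ ≤ _ := sq_sum_le_card_mul_sum_sq

/-! ### The response to a delta train and its Zak transform -/

theorem character_add (ν x y : ℝ) : character ν (x + y) = character ν x * character ν y := by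
  rw [character, character, character, ← Complex.exp_add]
  congr 1
  push_cast
  ring

theorem character_intCast (n : ℤ) : character 1 n = 1 := by
  rw [character, Complex.exp_eq_one_iff]
  exact ⟨n, by push_cast; ring⟩

theorem measurable_character : Measurable fun p : ℝ × ℝ => character p.1 p.2 := by
  unfold character
  fun_prop

/-- The density of the response `∬ η(t,ν) M_ν T_t III_c dt dν` to a weighted delta train. -/
noncomputable def deltaTrainResponse (a : ℝ) {L : ℕ} (c : ZMod L → ℂ) (η : ℝ × ℝ → ℂ) (x : ℝ) : ℂ :=
  ∑' m : ℤ, c (m : ZMod L) * ∫ ν, η (x - a * m, ν) * character ν x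

/-- The Zak transform of the response to a weighted delta train, as a weighted periodization of
the spreading function. -/
noncomputable def zakResponse (a b : ℝ) {L : ℕ} (c : ZMod L → ℂ) (η : ℝ × ℝ → ℂ) (z : ℝ × ℝ) : ℂ :=
  b * ∑' m : ℤ, c (m : ZMod L) *
    ∑' n : ℤ, η (z.1 - a * m, z.2 + b * n) * character (z.2 + b * n) z.1

/-- `η` is a measurable square integrable function supported in the square `[-R, R]²`. -/
structure IsSquareSupported (R : ℝ) (η : ℝ × ℝ → ℂ) : Prop where
  measurable : Measurable η
  eq_zero : ∀ t ν : ℝ, R < |t| ∨ R < |ν| → η (t, ν) = 0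
  lintegral_lt_top : ∫⁻ z, ‖η z‖ₑ ^ 2 < ⊤

section

variable {Ω : Type*} [MeasurableSpace Ω] {a b : ℝ} {L : ℕ} (c : ZMod L → ℂ)

theorem measurable_deltaTrainResponse {η : ℝ × ℝ → Ω → ℂ} (hη : Measurable (Function.uncurry η)) :
    Measurable fun p : ℝ × Ω => deltaTrainResponse a c (fun z => η z p.2) p.1 := by
  refine Measurable.tsum fun m => Measurable.const_mul ?_ _
  have h : StronglyMeasurable fun q : (ℝ × Ω) × ℝ =>
      η (q.1.1 - a * m, q.2) q.1.2 * character q.2 q.1.1 := by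
    refine Measurable.stronglyMeasurable (Measurable.mul ?_ ?_)
    · exact hη.comp (((measurable_fst.fst.sub_const _).prodMk measurable_snd).prodMk
        measurable_fst.snd)
    · exact measurable_character.comp (measurable_snd.prodMk measurable_fst.fst)
  exact h.integral_prod_right'.measurable

theorem measurable_zakResponse {η : ℝ × ℝ → Ω → ℂ} (hη : Measurable (Function.uncurry η)) :
    Measurable fun p : (ℝ × ℝ) × Ω => zakResponse a b c (fun z => η z p.2) p.1 := by
  refine Measurable.const_mul (Measurable.tsum fun m => Measurable.const_mul
    (Measurable.tsum fun n => Measurable.mul ?_ ?_) _) _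
  · exact hη.comp (((measurable_fst.fst.sub_const _).prodMk (measurable_fst.snd.add_const _)).prodMk
      measurable_snd)
  · exact measurable_character.comp ((measurable_fst.snd.add_const _).prodMk measurable_fst.fst)

end

theorem measurable_deltaTrainResponse_path {a : ℝ} {L : ℕ} (c : ZMod L → ℂ) {η : ℝ × ℝ → ℂ}
    (hη : Measurable η) : Measurable (deltaTrainResponse a c η) :=
  (measurable_deltaTrainResponse (Ω := Unit) c (η := fun z _ => η z)
    (hη.comp measurable_fst)).comp (measurable_id.prodMk (measurable_const (a := ())))

theorem measurable_zakResponse_path {a b : ℝ} {L : ℕ} (c : ZMod L → ℂ) {η : ℝ × ℝ → ℂ}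
    (hη : Measurable η) : Measurable (zakResponse a b c η) := by
  have hη' : Measurable (Function.uncurry fun (z : ℝ × ℝ) (_ : Unit) => η z) :=
    hη.comp measurable_fst
  have h := measurable_zakResponse (a := a) (b := b) c hη'
  have h' : Measurable fun z : ℝ × ℝ => (z, ()) := measurable_id.prodMk measurable_const
  have h'' := h.comp h'
  simp only [Function.comp_def] at h''
  exact h''

theorem character_mul_intCast {b β : ℝ} (hβ : β * b = 1) (q n : ℤ) :
    character (β * q) (b * n) = 1 := by
  have h := character_intCast (q * n)
  rw [← h, character, character]
  congr 1
  have h' : (β : ℂ) * b = 1 := by exact_mod_cast hβ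
  push_cast
  linear_combination 2 * Real.pi * Complex.I * q * n * h'

theorem periodic_character {b β : ℝ} (hβ : β * b = 1) (q : ℤ) :
    Function.Periodic (character (β * q)) b := by
  intro ξ
  rw [character_add]
  have := character_mul_intCast hβ q 1
  rw [Int.cast_one, mul_one] at this
  rw [this, mul_one]

theorem periodic_zakResponse {a b : ℝ} {L : ℕ} (c : ZMod L → ℂ) (η : ℝ × ℝ → ℂ) (x : ℝ) :
    Function.Periodic (fun ξ => zakResponse a b c η (x, ξ)) b := by
  intro ξ
  simp only [zakResponse]
  congr 1
  refine tsum_congr fun m => ?_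
  congr 1
  rw [← (Equiv.addRight (1 : ℤ)).tsum_eq fun n : ℤ =>
    η (x - a * m, ξ + b * n) * character (ξ + b * n) x]
  refine tsum_congr fun n => ?_
  have : ξ + b + b * n = ξ + b * ((Equiv.addRight (1 : ℤ)) n : ℤ) := by
    simp only [Equiv.coe_addRight]
    push_cast
    ring
  rw [this]

namespace IsSquareSupported

variable {R : ℝ} {η : ℝ × ℝ → ℂ} {a b : ℝ} {L : ℕ}

/-- Only finitely many lattice translates of a bounded set meet `[-R, R]²`. The index sets are fixed
before `c` and `η`, so estimates derived from them hold uniformly over all sample paths. -/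
theorem exists_zakResponse_eq_sum (ha : 0 < a) (hb : 0 < b) (R X : ℝ) :
    ∃ A B : Finset ℤ, ∀ {L : ℕ} (c : ZMod L → ℂ) {η : ℝ × ℝ → ℂ}, IsSquareSupported R η →
      (∀ m ∉ A, ∀ x, |x| ≤ X → ∀ ν, η (x - a * m, ν) = 0) ∧
      (∀ n ∉ B, ∀ ξ, |ξ| ≤ X → ∀ t, η (t, ξ + b * n) = 0) ∧
      ∀ x ξ, |x| ≤ X → |ξ| ≤ X → zakResponse a b c η (x, ξ) = b * ∑ m ∈ A, c (m : ZMod L) *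
        ∑ n ∈ B, η (x - a * m, ξ + b * n) * character (ξ + b * n) x := by
  obtain ⟨A, hA⟩ := exists_finset_lt_abs_sub_mul ha R X
  obtain ⟨B, hB⟩ := exists_finset_lt_abs_add_mul hb R X
  refine ⟨A, B, fun {L} c {η} hη => ⟨fun m hm x hx ν => hη.eq_zero _ _ (Or.inl (hA m hm x hx)),
    fun n hn ξ hξ t => hη.eq_zero _ _ (Or.inr (hB n hn ξ hξ)), fun x ξ hx hξ => ?_⟩⟩
  rw [zakResponse, tsum_eq_sum (s := A)]
  · congr 1
    refine Finset.sum_congr rfl fun m _ => ?_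
    rw [tsum_eq_sum (s := B)]
    intro n hn
    rw [hη.eq_zero _ _ (Or.inr (hB n hn ξ hξ)), zero_mul]
  · intro m hm
    simp [hη.eq_zero _ _ (Or.inl (hA m hm x hx))]

theorem exists_lintegral_zakResponse_le (ha : 0 < a) (hb : 0 < b) (c : ZMod L → ℂ) (R X : ℝ) :
    ∃ C : ℝ≥0∞, C < ⊤ ∧ ∀ η : ℝ × ℝ → ℂ, IsSquareSupported R η →
      ∫⁻ z in Icc (-X) X ×ˢ Icc (-X) X, ‖zakResponse a b c η z‖ₑ ^ 2 ≤ C * ∫⁻ z, ‖η z‖ₑ ^ 2 := by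
  obtain ⟨A, B, hAB⟩ := exists_zakResponse_eq_sum ha hb R X
  refine ⟨‖(b : ℂ)‖ₑ ^ 2 * ((A ×ˢ B).card * ∑ p ∈ A ×ˢ B, ‖c (p.1 : ZMod L)‖ₑ ^ 2), ?_,
    fun η hη => ?_⟩
  · refine ENNReal.mul_lt_top (ENNReal.pow_lt_top enorm_lt_top) (ENNReal.mul_lt_top (ENNReal.natCast_lt_top _)
      (ENNReal.sum_lt_top.mpr fun p _ => ENNReal.pow_lt_top enorm_lt_top))
  obtain ⟨-, -, hF⟩ := hAB c hη
  set w : ℤ × ℤ → ℝ × ℝ → ℂ := fun p z =>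
    c (p.1 : ZMod L) * (η (z.1 - a * p.1, z.2 + b * p.2) * character (z.2 + b * p.2) z.1) with hw
  have hpt : ∀ z ∈ Icc (-X) X ×ˢ Icc (-X) X, ‖zakResponse a b c η z‖ₑ ^ 2 ≤
      ‖(b : ℂ)‖ₑ ^ 2 * ((A ×ˢ B).card * ∑ p ∈ A ×ˢ B, ‖w p z‖ₑ ^ 2) := by
    rintro ⟨x, ξ⟩ ⟨hx, hξ⟩
    rw [hF x ξ (abs_le.mpr hx) (abs_le.mpr hξ), enorm_mul, mul_pow]
    gcongr
    refine le_trans (le_of_eq ?_) (enorm_sum_sq_le _ _)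
    rw [Finset.sum_product]
    simp only [hw, Finset.mul_sum]
  have hwm : ∀ p, Measurable fun z => ‖w p z‖ₑ ^ 2 := by
    intro p
    refine Measurable.pow_const (Measurable.enorm (Measurable.const_mul (Measurable.mul ?_ ?_) _)) _
    · exact hη.measurable.comp ((measurable_fst.sub_const _).prodMk (measurable_snd.add_const _))
    · exact measurable_character.comp ((measurable_snd.add_const _).prodMk measurable_fst)
  have hwint : ∀ p, ∫⁻ z, ‖w p z‖ₑ ^ 2 = ‖c (p.1 : ZMod L)‖ₑ ^ 2 * ∫⁻ z, ‖η z‖ₑ ^ 2 := by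
    intro p
    have h : ∀ z : ℝ × ℝ, ‖w p z‖ₑ ^ 2 =
        ‖c (p.1 : ZMod L)‖ₑ ^ 2 * ‖η (z + (-(a * p.1), b * p.2))‖ₑ ^ 2 := by
      intro z
      have h1 : ‖character (z.2 + b * p.2) z.1‖ₑ = 1 := by
        rw [← ofReal_norm, norm_character, ENNReal.ofReal_one]
      simp only [hw, enorm_mul, h1, mul_one, mul_pow]
      rfl
    rw [lintegral_congr h, lintegral_const_mul' _ _ (ENNReal.pow_ne_top enorm_ne_top),
      lintegral_add_right_eq_self fun z => ‖η z‖ₑ ^ 2]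
  calc ∫⁻ z in Icc (-X) X ×ˢ Icc (-X) X, ‖zakResponse a b c η z‖ₑ ^ 2
      ≤ ∫⁻ z in Icc (-X) X ×ˢ Icc (-X) X,
          ‖(b : ℂ)‖ₑ ^ 2 * ((A ×ˢ B).card * ∑ p ∈ A ×ˢ B, ‖w p z‖ₑ ^ 2) :=
        setLIntegral_mono' (measurableSet_Icc.prod measurableSet_Icc) hpt
    _ ≤ ∫⁻ z, ‖(b : ℂ)‖ₑ ^ 2 * ((A ×ˢ B).card * ∑ p ∈ A ×ˢ B, ‖w p z‖ₑ ^ 2) :=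
        setLIntegral_le_lintegral _ _
    _ = _ := by
        rw [lintegral_const_mul' _ _ (ENNReal.pow_ne_top enorm_ne_top),
          lintegral_const_mul' _ _ (ENNReal.natCast_ne_top _),
          lintegral_finsetSum _ fun p _ => hwm p, Finset.sum_congr rfl fun p _ => hwint p,
          ← Finset.sum_mul]
        ring

/-- The Fourier coefficients of the fibers of `zakResponse` are values of the response. -/
theorem deltaTrainResponse_sub_eq (hη : IsSquareSupported R η) (ha : 0 < a) (hb : 0 < b)
    (hab : a * L * b = 1) (c : ZMod L → ℂ) {x : ℝ}
    (hx : ∀ m : ℤ, Integrable fun ν => η (x - a * m, ν)) (q : ℤ) :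
    deltaTrainResponse a c η (x - a * q * L) = (a * L : ℝ) *
      ∫ ξ in Ioc 0 b, zakResponse a b c η (x, ξ) * character (-(a * L * q)) ξ := by
  -- The radius covers both the fixed `x` and all `ξ` in the period `(0, b]`.
  obtain ⟨A, B, hAB⟩ := exists_zakResponse_eq_sum ha hb R (max |x| b)
  obtain ⟨hA, hB, hF⟩ := hAB c hη
  set g : ℤ → ℝ → ℂ := fun m ν =>
    η (x - a * m, ν) * character ν x * character (-(a * L * q)) ν with hg
  have hgi : ∀ m, Integrable (g m) := by
    intro m
    refine (hx m).mono ?_ (Eventually.of_forall fun ν => ?_)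
    · refine Measurable.aestronglyMeasurable (Measurable.mul (Measurable.mul ?_ ?_) ?_)
      · exact hη.measurable.comp measurable_prodMk_left
      · exact measurable_character.comp (measurable_id.prodMk measurable_const)
      · exact measurable_character.comp (measurable_const.prodMk measurable_id)
    · simp [hg, norm_character]
  have hunfold : ∀ m, ∫ ν, g m ν = ∑ n ∈ B, ∫ ξ in Ioc 0 b, g m (ξ + b * n) := by
    intro m
    rw [← (hasSum_integral_Ioc hb (hgi m)).tsum_eq, tsum_eq_sum (s := B)]
    intro n hn
    refine (setIntegral_congr_fun (g := fun _ => 0) measurableSet_Ioc fun ξ hξ => ?_).trans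
      (integral_zero _ _)
    have : |ξ| ≤ max |x| b := (abs_le.mpr ⟨by linarith [hξ.1], hξ.2⟩).trans (le_max_right _ _)
    simp [hg, hB n hn ξ this]
  have hfib : ∀ ξ ∈ Ioc 0 b, zakResponse a b c η (x, ξ) * character (-(a * L * q)) ξ =
      b * ∑ m ∈ A, c (m : ZMod L) * ∑ n ∈ B, g m (ξ + b * n) := by
    intro ξ hξ
    have : |ξ| ≤ max |x| b := (abs_le.mpr ⟨by linarith [hξ.1], hξ.2⟩).trans (le_max_right _ _)
    rw [hF x ξ (le_max_left _ _) this, mul_assoc, Finset.sum_mul]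
    congr 1
    refine Finset.sum_congr rfl fun m _ => ?_
    rw [mul_assoc, Finset.sum_mul]
    congr 1
    refine Finset.sum_congr rfl fun n _ => ?_
    -- Since `aLb = 1`, this character is `b`-periodic and can be moved inside the sum over `n`,
    -- which then unfolds to an integral over the line.
    have h1 : character (-(a * L * q)) (ξ + b * n) = character (-(a * L * q)) ξ := by
      rw [character_add]
      have := character_mul_intCast hab (-q) n
      push_cast at this
      rw [mul_neg] at this
      rw [this, mul_one]
    simp only [hg]
    rw [h1]
  have hgi' : ∀ m n : ℤ, IntegrableOn (fun ξ => g m (ξ + b * n)) (Ioc 0 b) :=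
    fun m n => ((hgi m).comp_add_right _).integrableOn
  rw [setIntegral_congr_fun measurableSet_Ioc hfib, integral_const_mul,
    integral_finsetSum _ fun m _ => (integrable_finsetSum _ fun n _ => hgi' m n).const_mul _]
  simp only [integral_const_mul]
  rw [← mul_assoc, ← Complex.ofReal_mul, hab, Complex.ofReal_one, one_mul]
  have h2 : ∀ m ∈ A, c (m : ZMod L) * ∫ ξ in Ioc 0 b, ∑ n ∈ B, g m (ξ + b * n) =
      c (m : ZMod L) * ∫ ν, η (x - a * m, ν) * character ν (x - a * q * L) := by
    intro m _
    rw [integral_finsetSum _ fun n _ => hgi' m n, ← hunfold]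
    congr 2
    ext ν
    simp only [hg]
    rw [mul_assoc]
    congr 1
    rw [character, character, character, ← Complex.exp_add]
    congr 1
    push_cast
    ring
  -- Translating `x` by `aLq` shifts the delta index by `Lq`, which the `L`-periodic weights do not
  -- see.
  rw [Finset.sum_congr rfl h2, ← tsum_eq_sum (L := SummationFilter.unconditional ℤ) (f := fun m : ℤ => c (m : ZMod L) *
    ∫ ν, η (x - a * m, ν) * character ν (x - a * q * L)), deltaTrainResponse,
    ← (Equiv.subRight (L * q : ℤ)).tsum_eq]
  · refine tsum_congr fun m => ?_
    simp only [Equiv.subRight_apply]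
    congr 2
    · simp
    · ext ν
      congr 3
      push_cast
      ring
  · intro m hm
    simp [hA m hm x (le_max_left _ _)]

end IsSquareSupported

theorem memLp_two_iff_lintegral_lt_top {α : Type*} [MeasurableSpace α] {μ : Measure α} {f : α → ℂ}
    (hf : AEStronglyMeasurable f μ) : MemLp f 2 μ ↔ ∫⁻ x, ‖f x‖ₑ ^ 2 ∂μ < ⊤ := by
  have h2 := eLpNorm_nnreal_pow_eq_lintegral (f := f) (μ := μ) (p := 2) two_ne_zero
  simp only [NNReal.coe_ofNat, ENNReal.coe_ofNat, ENNReal.rpow_ofNat] at h2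
  rw [← h2, MemLp, and_iff_right hf]
  exact (ENNReal.pow_lt_top_iff.trans (or_iff_left two_ne_zero)).symm

theorem periodic_zakPartialSum {a b : ℝ} {L : ℕ} (hab : a * L * b = 1) (N : ℕ) (f : ℝ → ℂ) (x : ℝ) :
    Function.Periodic (fun ξ => zakPartialSum a L N f (x, ξ)) b := by
  intro ξ
  simp only [zakPartialSum]
  exact Finset.sum_congr rfl fun n _ => by rw [periodic_character hab n ξ]

theorem measurable_zakPartialSum {Ω : Type*} [MeasurableSpace Ω] {a : ℝ} {L : ℕ} (N : ℕ)
    {f : ℝ → Ω → ℂ} (hf : Measurable (Function.uncurry f)) :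
    Measurable fun p : (ℝ × ℝ) × Ω => zakPartialSum a L N (fun x => f x p.2) p.1 := by
  refine Finset.measurable_fun_sum _ fun n _ => Measurable.mul ?_ ?_
  · exact hf.comp ((measurable_fst.fst.sub_const _).prodMk measurable_snd)
  · exact measurable_character.comp (measurable_const.prodMk measurable_fst.snd)

theorem measurable_zakPartialSum_path {a : ℝ} {L : ℕ} (N : ℕ) {f : ℝ → ℂ} (hf : Measurable f) :
    Measurable (zakPartialSum a L N f) := by
  refine Finset.measurable_fun_sum _ fun n _ => Measurable.mul ?_ ?_
  · exact hf.comp (measurable_fst.sub_const _)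
  · exact measurable_character.comp (measurable_const.prodMk measurable_snd)

theorem setLIntegral_prod_eq {s t : Set ℝ} {h : ℝ × ℝ → ℝ≥0∞} (hh : Measurable h) :
    ∫⁻ z in s ×ˢ t, h z = ∫⁻ x in s, ∫⁻ ξ in t, h (x, ξ) := by
  rw [Measure.volume_eq_prod, ← Measure.prod_restrict, lintegral_prod _ hh.aemeasurable]

namespace IsSquareSupported

variable {R : ℝ} {η : ℝ × ℝ → ℂ} {a b : ℝ} {L : ℕ}

theorem integrable (hη : IsSquareSupported R η) : Integrable η := by
  have h1 : MemLp η 2 :=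
    (memLp_two_iff_lintegral_lt_top hη.measurable.aestronglyMeasurable).mpr hη.lintegral_lt_top
  set s : Set (ℝ × ℝ) := Icc (-R) R ×ˢ Icc (-R) R with hs
  have hfin : volume s < ⊤ := (isCompact_Icc.prod isCompact_Icc).measure_lt_top
  have : IsFiniteMeasure (volume.restrict s) := ⟨by rwa [Measure.restrict_apply_univ]⟩
  have h2 : IntegrableOn η s := (h1.restrict s).integrable (by norm_num)
  refine (integrableOn_iff_integrable_of_support_subset ?_).mp h2
  rintro ⟨t, ν⟩ hz
  by_contra hcon
  refine hz (hη.eq_zero t ν ?_)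
  by_contra! h
  exact hcon ⟨abs_le.mp h.1, abs_le.mp h.2⟩

theorem ae_integrable_fiber (hη : IsSquareSupported R η) (a : ℝ) :
    ∀ᵐ x : ℝ, ∀ m : ℤ, Integrable fun ν => η (x - a * m, ν) := by
  rw [ae_all_iff]
  intro m
  have h : ∀ᵐ t : ℝ, Integrable fun ν => η (t, ν) := by
    have := hη.integrable
    rw [Measure.volume_eq_prod] at this
    exact this.prod_right_ae
  exact (measurePreserving_sub_right volume (a * (m : ℝ))).quasiMeasurePreserving.ae h

theorem exists_lintegral_fiber_zakResponse_le (ha : 0 < a) (hb : 0 < b) (c : ZMod L → ℂ)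
    (R X : ℝ) :
    ∃ C : ℝ≥0∞, C < ⊤ ∧ ∀ η : ℝ × ℝ → ℂ, IsSquareSupported R η →
      ∫⁻ x in Icc (-X) X, ∫⁻ ξ in Ioc 0 b, ‖zakResponse a b c η (x, ξ)‖ₑ ^ 2 ≤
        C * ∫⁻ z, ‖η z‖ₑ ^ 2 := by
  obtain ⟨C, hC, h⟩ := exists_lintegral_zakResponse_le ha hb c R (max X b)
  refine ⟨C, hC, fun η hη => le_trans ?_ (h η hη)⟩
  rw [← setLIntegral_prod_eq (h := fun z => ‖zakResponse a b c η z‖ₑ ^ 2)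
    ((measurable_zakResponse_path c hη.measurable).enorm.pow_const 2)]
  refine lintegral_mono_set (prod_mono (Icc_subset_Icc ?_ (le_max_left _ _)) fun ξ hξ => ?_)
  · exact neg_le_neg (le_max_left _ _)
  · exact ⟨by linarith [hξ.1, le_max_right X b], hξ.2.trans (le_max_right _ _)⟩

/-- For almost every `x` the fiber of `zakResponse` is square integrable with the response values as
Fourier coefficients, so the Zak partial sums are its symmetric Fourier sums. -/
theorem fiber_partialSum (hη : IsSquareSupported R η) (ha : 0 < a) (hb : 0 < b)
    (hab : a * L * b = 1) (c : ZMod L → ℂ) (X : ℝ) :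
    ∀ᵐ x ∂(volume.restrict (Icc (-X) X)),
      Tendsto (fun N : ℕ => ∫⁻ ξ in Ioc 0 b, ‖zakResponse a b c η (x, ξ) -
        zakPartialSum a L N (deltaTrainResponse a c η) (x, ξ)‖ₑ ^ 2) atTop (𝓝 0) ∧
      (∀ N : ℕ, ∫⁻ ξ in Ioc 0 b, ‖zakResponse a b c η (x, ξ) -
        zakPartialSum a L N (deltaTrainResponse a c η) (x, ξ)‖ₑ ^ 2 ≤
          ∫⁻ ξ in Ioc 0 b, ‖zakResponse a b c η (x, ξ)‖ₑ ^ 2) ∧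
      ∑' q : ℤ, ‖deltaTrainResponse a c η (x - a * q * L)‖ₑ ^ 2 ≤
        ENNReal.ofReal (a * L) * ∫⁻ ξ in Ioc 0 b, ‖zakResponse a b c η (x, ξ)‖ₑ ^ 2 := by
  obtain ⟨C, hC, hbound⟩ := exists_lintegral_fiber_zakResponse_le ha hb c R X
  have hFm := measurable_zakResponse_path (a := a) (b := b) c hη.measurable
  have hfin : ∀ᵐ x ∂(volume.restrict (Icc (-X) X)),
      ∫⁻ ξ in Ioc 0 b, ‖zakResponse a b c η (x, ξ)‖ₑ ^ 2 < ⊤ :=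
    ae_lt_top (hFm.enorm.pow_const 2).lintegral_prod_right'
      ((hbound η hη).trans_lt (ENNReal.mul_lt_top hC hη.lintegral_lt_top)).ne
  filter_upwards [hfin, ae_restrict_of_ae (hη.ae_integrable_fiber a)] with x hx hxi
  have hm : Measurable fun ξ => zakResponse a b c η (x, ξ) := by
    have := hFm.comp (measurable_prodMk_left (x := x))
    simpa only [Function.comp_def] using this
  have hmem := (memLp_two_iff_lintegral_lt_top hm.aestronglyMeasurable).mpr hx
  have h := exists_fourier_partialSum_L2 hb hab hmem (hη.deltaTrainResponse_sub_eq ha hb hab c hxi)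
  simpa only [zakPartialSum] using h

/-- Cutting the line into periods of length `aL` presents the norm as an integral over `x` of sums
of squared Fourier coefficients, to which Bessel's inequality applies. -/
theorem lintegral_deltaTrainResponse_lt_top (hη : IsSquareSupported R η) (ha : 0 < a)
    (hb : 0 < b) (hab : a * L * b = 1) (c : ZMod L → ℂ) :
    ∫⁻ x, ‖deltaTrainResponse a c η x‖ₑ ^ 2 < ⊤ := by
  have haL : 0 < a * L := pos_of_mul_pos_left (hab ▸ one_pos) hb.le
  obtain ⟨C, hC, hbound⟩ := exists_lintegral_fiber_zakResponse_le ha hb c R (a * L)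
  have hfm := measurable_deltaTrainResponse_path (a := a) c hη.measurable
  have hsub : Ioc 0 (a * L) ⊆ Icc (-(a * L)) (a * L) := fun x hx =>
    ⟨by linarith [hx.1], hx.2⟩
  calc ∫⁻ x, ‖deltaTrainResponse a c η x‖ₑ ^ 2
      = ∫⁻ x in Ioc 0 (a * L), ∑' q : ℤ, ‖deltaTrainResponse a c η (x + a * L * q)‖ₑ ^ 2 := by
        rw [lintegral_eq_tsum_Ioc haL, lintegral_tsum fun q => ?_]
        exact ((hfm.comp (measurable_id.add_const _)).enorm.pow_const 2).aemeasurable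
    _ = ∫⁻ x in Ioc 0 (a * L), ∑' q : ℤ, ‖deltaTrainResponse a c η (x - a * q * L)‖ₑ ^ 2 := by
        refine lintegral_congr fun x => ?_
        rw [← (Equiv.neg ℤ).tsum_eq]
        refine tsum_congr fun q => ?_
        congr 3
        simp only [Equiv.neg_apply]
        push_cast
        ring
    _ ≤ ∫⁻ x in Icc (-(a * L)) (a * L),
          ∑' q : ℤ, ‖deltaTrainResponse a c η (x - a * q * L)‖ₑ ^ 2 := lintegral_mono_set hsub
    _ ≤ ∫⁻ x in Icc (-(a * L)) (a * L), ENNReal.ofReal (a * L) *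
          ∫⁻ ξ in Ioc 0 b, ‖zakResponse a b c η (x, ξ)‖ₑ ^ 2 :=
        lintegral_mono_ae ((hη.fiber_partialSum ha hb hab c (a * L)).mono fun x hx => hx.2.2)
    _ < ⊤ := by
        rw [lintegral_const_mul' _ _ ENNReal.ofReal_ne_top]
        exact ENNReal.mul_lt_top ENNReal.ofReal_lt_top
          ((hbound η hη).trans_lt (ENNReal.mul_lt_top hC hη.lintegral_lt_top))

/-- Periodicity in `ξ` reduces the square to one period, where the fiberwise error tends to zero and
is dominated by the fiber norm. The constant precedes `η`, so the bound can later be integrated over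
`ω`. -/
theorem exists_lintegral_square_sub_zakPartialSum_le (ha : 0 < a) (hb : 0 < b)
    (hab : a * L * b = 1) (c : ZMod L → ℂ) (R X : ℝ) :
    ∃ C : ℝ≥0∞, C < ⊤ ∧ ∀ η : ℝ × ℝ → ℂ, IsSquareSupported R η →
      (∀ N, ∫⁻ z in Icc (-X) X ×ˢ Icc (-X) X,
        ‖zakResponse a b c η z - zakPartialSum a L N (deltaTrainResponse a c η) z‖ₑ ^ 2 ≤
          C * ∫⁻ z, ‖η z‖ₑ ^ 2) ∧
      Tendsto (fun N => ∫⁻ z in Icc (-X) X ×ˢ Icc (-X) X,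
        ‖zakResponse a b c η z - zakPartialSum a L N (deltaTrainResponse a c η) z‖ₑ ^ 2)
        atTop (𝓝 0) := by
  obtain ⟨P, hP⟩ := exists_lintegral_periodic_le hb X
  obtain ⟨C, hC, hbound⟩ := exists_lintegral_fiber_zakResponse_le ha hb c R X
  refine ⟨P * C, ENNReal.mul_lt_top (ENNReal.natCast_lt_top _) hC, fun η hη => ?_⟩
  have hm : ∀ N, Measurable fun z => ‖zakResponse a b c η z -
      zakPartialSum a L N (deltaTrainResponse a c η) z‖ₑ ^ 2 := fun N =>
    ((measurable_zakResponse_path c hη.measurable).sub (measurable_zakPartialSum_path N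
      (measurable_deltaTrainResponse_path c hη.measurable))).enorm.pow_const 2
  have hfib := hη.fiber_partialSum ha hb hab c X
  have hle : ∀ N, ∫⁻ z in Icc (-X) X ×ˢ Icc (-X) X,
      ‖zakResponse a b c η z - zakPartialSum a L N (deltaTrainResponse a c η) z‖ₑ ^ 2 ≤
        P * ∫⁻ x in Icc (-X) X, ∫⁻ ξ in Ioc 0 b, ‖zakResponse a b c η (x, ξ) -
          zakPartialSum a L N (deltaTrainResponse a c η) (x, ξ)‖ₑ ^ 2 := by
    intro N
    rw [setLIntegral_prod_eq (hm N), ← lintegral_const_mul' _ _ (ENNReal.natCast_ne_top _)]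
    refine lintegral_mono fun x => hP _ fun ξ => ?_
    have h1 := periodic_zakResponse (a := a) (b := b) c η x ξ
    have h2 := periodic_zakPartialSum hab N (deltaTrainResponse a c η) x ξ
    simp only at h1 h2
    simp only [h1, h2]
  refine ⟨fun N => (hle N).trans ?_, ?_⟩
  · rw [mul_assoc]
    gcongr
    exact (lintegral_mono_ae (hfib.mono fun x hx => hx.2.1 N)).trans (hbound η hη)
  · have hdct := tendsto_lintegral_of_dominated_convergence
      (μ := volume.restrict (Icc (-X) X))
      (F := fun N x => ∫⁻ ξ in Ioc 0 b, ‖zakResponse a b c η (x, ξ) -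
          zakPartialSum a L N (deltaTrainResponse a c η) (x, ξ)‖ₑ ^ 2) (f := fun _ => 0)
      (fun x => ∫⁻ ξ in Ioc 0 b, ‖zakResponse a b c η (x, ξ)‖ₑ ^ 2)
      (fun N => (hm N).lintegral_prod_right')
      (fun N => hfib.mono fun x hx => hx.2.1 N)
      ((hbound η hη).trans_lt (ENNReal.mul_lt_top hC hη.lintegral_lt_top)).ne
      (hfib.mono fun x hx => hx.1)
    rw [lintegral_zero] at hdct
    have h3 := ENNReal.Tendsto.const_mul (a := (P : ℝ≥0∞)) hdct
      (Or.inr (ENNReal.natCast_ne_top _))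
    rw [mul_zero] at h3
    exact tendsto_of_tendsto_of_tendsto_of_le_of_le tendsto_const_nhds h3
      (fun _ => zero_le) hle

theorem isZakTransform (hη : IsSquareSupported R η) (ha : 0 < a) (hb : 0 < b)
    (hab : a * L * b = 1) (c : ZMod L → ℂ) :
    IsZakTransform a L (deltaTrainResponse a c η) (zakResponse a b c η) := by
  intro K hK
  obtain ⟨X, hX⟩ := hK.isBounded.exists_norm_le
  obtain ⟨C, -, h⟩ := exists_lintegral_square_sub_zakPartialSum_le ha hb hab c R X
  refine tendsto_of_tendsto_of_tendsto_of_le_of_le tendsto_const_nhds (h η hη).2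
    (fun _ => zero_le) fun N => lintegral_mono_set fun z hz => ?_
  have := hX z hz
  rw [Prod.norm_def] at this
  exact ⟨abs_le.mp (max_le_iff.mp this).1, abs_le.mp (max_le_iff.mp this).2⟩

end IsSquareSupported

/-! ### The response as a tempered distribution -/

theorem hasSum_timeFreqShift_deltaTrain {a : ℝ} (ha : 0 < a) {L : ℕ} [NeZero L] (c : ZMod L → ℂ)
    (φ : 𝓢(ℝ, ℂ)) (t ν : ℝ) :
    HasSum (fun m : ℤ => c (m : ZMod L) * (character ν (t + a * m) * φ (t + a * m)))
      (timeFreqShift t ν (deltaTrain a c) φ) := by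
  have h := deltaTrain_apply ha c (SchwartzMap.compSubConstCLM ℂ (-t)
    (SchwartzMap.smulLeftCLM ℂ (character ν) φ))
  refine (congrArg (fun u : ℤ → ℂ => HasSum u _) (funext fun m => ?_)).mp h
  congr 1
  change (SchwartzMap.smulLeftCLM ℂ (character ν) φ) (a * m - -t) = _
  rw [SchwartzMap.smulLeftCLM_apply_apply (hasTemperateGrowth_character ν), sub_neg_eq_add,
    add_comm, smul_eq_mul]

/-- Quadratic decay gives a summable majorant uniform in bounded `t`; it justifies exchanging the
lattice sum with the integral against `η`. -/
theorem SchwartzMap.exists_summable_norm_lattice_le {a : ℝ} (ha : 0 < a) (φ : 𝓢(ℝ, ℂ)) (R : ℝ) :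
    ∃ w : ℤ → ℝ, Summable w ∧ ∀ t, |t| ≤ R → ∀ m : ℤ, ‖φ (t + a * m)‖ ≤ w m := by
  obtain ⟨C, hC0, hC⟩ : ∃ C : ℝ, 0 ≤ C ∧ ∀ x, (1 + ‖x‖) ^ 2 * ‖φ x‖ ≤ C := by
    have h := fun x => SchwartzMap.one_add_le_sup_seminorm_apply (𝕜 := ℝ) (m := (2, 0)) (k := 2)
      (n := 0) le_rfl le_rfl φ x
    simp only [norm_iteratedFDeriv_zero] at h
    exact ⟨_, (by positivity : 0 ≤ (1 + ‖(0 : ℝ)‖) ^ 2 * ‖φ 0‖).trans (h 0), h⟩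
  -- At `m = 0` the first summand is zero by the convention `1 / 0 = 0`, so the second one supplies
  -- the bound.
  refine ⟨fun m => C * (1 + |R|) ^ 2 / a ^ 2 * (1 / (m : ℝ) ^ 2) + if m = 0 then C else 0, ?_, ?_⟩
  · refine Summable.add (Summable.mul_left _ (Real.summable_one_div_int_pow.mpr one_lt_two)) ?_
    exact summable_of_ne_finset_zero (s := {0}) (fun m hm => by simp_all)
  · intro t ht m
    have hx := hC (t + a * m)
    rw [Real.norm_eq_abs] at hx
    by_cases hm : m = 0
    · subst hm
      have h1 : (1 : ℝ) ≤ (1 + |t + a * (0 : ℤ)|) ^ 2 := by nlinarith [abs_nonneg (t + a * (0 : ℤ))]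
      have h2 := mul_le_mul_of_nonneg_right h1 (norm_nonneg (φ (t + a * (0 : ℤ))))
      simp only [Int.cast_zero, if_true]
      simp only [Int.cast_zero] at h2 hx
      norm_num
      norm_num at h2 hx
      linarith
    · simp only [if_neg hm, add_zero]
      have hm' : 0 < (m : ℝ) ^ 2 := by
        have : (m : ℝ) ≠ 0 := by exact_mod_cast hm
        positivity
      have hR : |t| ≤ |R| := ht.trans (le_abs_self R)
      have h1 : |a * m| ≤ (1 + |R|) * (1 + |t + a * m|) := by
        have h2 : |a * m| ≤ |t + a * m| + |t| := by
          have := abs_sub (t + a * m) t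
          rwa [add_sub_cancel_left] at this
        nlinarith [abs_nonneg R, abs_nonneg (t + a * m),
          mul_nonneg (abs_nonneg R) (abs_nonneg (t + a * m))]
      have h3 : (a * m) ^ 2 ≤ (1 + |R|) ^ 2 * (1 + |t + a * m|) ^ 2 := by
        rw [← sq_abs, ← mul_pow]
        gcongr
      rw [div_mul_div_comm, mul_one, le_div_iff₀ (by positivity)]
      calc ‖φ (t + a * m)‖ * (a ^ 2 * (m : ℝ) ^ 2) = ‖φ (t + a * m)‖ * (a * m) ^ 2 := by ring
        _ ≤ ‖φ (t + a * m)‖ * ((1 + |R|) ^ 2 * (1 + |t + a * m|) ^ 2) := by gcongr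
        _ = (1 + |R|) ^ 2 * ((1 + |t + a * m|) ^ 2 * ‖φ (t + a * m)‖) := by ring
        _ ≤ (1 + |R|) ^ 2 * C := by gcongr
        _ = _ := by ring

namespace IsSquareSupported

variable {R : ℝ} {η : ℝ × ℝ → ℂ} {a : ℝ} {L : ℕ}

/-- Fubini, after the substitution `t = x - am` in the `m`-th term. Sum and integral are exchanged
once over the plane and once over the line, both times by summability of the integrals of norms. -/
theorem integral_deltaTrainResponse_mul [NeZero L] (hη : IsSquareSupported R η) (ha : 0 < a)
    (c : ZMod L → ℂ) (φ : 𝓢(ℝ, ℂ)) :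
    Integrable (fun z => η z * timeFreqShift z.1 z.2 (deltaTrain a c) φ) ∧
      ∫ x, deltaTrainResponse a c η x * φ x =
        ∫ z, η z * timeFreqShift z.1 z.2 (deltaTrain a c) φ := by
  obtain ⟨w, hw, hφw⟩ := φ.exists_summable_norm_lattice_le ha R
  obtain ⟨B, hB⟩ : ∃ B : ℝ, ∀ r, ‖c r‖ ≤ B := by
    obtain ⟨B, hB⟩ := (Set.finite_range fun r => ‖c r‖).bddAbove
    exact ⟨B, fun r => hB ⟨r, rfl⟩⟩
  have hB0 : 0 ≤ B := (norm_nonneg _).trans (hB 0)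
  set T : ℤ → ℝ × ℝ → ℂ := fun m z =>
    η z * (c (m : ZMod L) * (character z.2 (z.1 + a * m) * φ (z.1 + a * m))) with hT
  have hTm : ∀ m, Measurable (T m) := by
    intro m
    refine hη.measurable.mul (Measurable.const_mul (Measurable.mul ?_ ?_) _)
    · exact measurable_character.comp (measurable_snd.prodMk (measurable_fst.add_const _))
    · exact φ.continuous.measurable.comp (measurable_fst.add_const _)
  have hTle : ∀ m z, ‖T m z‖ ≤ B * w m * ‖η z‖ := by
    intro m z
    by_cases hz : |z.1| ≤ R
    · rw [hT, norm_mul, norm_mul, norm_mul, norm_character, one_mul, mul_comm]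
      gcongr
      · exact hB _
      · exact hφw _ hz m
    · have : η z = 0 := hη.eq_zero z.1 z.2 (Or.inl (not_le.mp hz))
      simp [hT, this]
  have hTi : ∀ m, Integrable (T m) := fun m =>
    (hη.integrable.norm.const_mul (B * w m)).mono' (hTm m).aestronglyMeasurable
      (Eventually.of_forall (hTle m))
  have hTint : ∀ m, ∫ z, ‖T m z‖ ≤ B * w m * ∫ z, ‖η z‖ := by
    intro m
    rw [← integral_const_mul]
    exact integral_mono (hTi m).norm (hη.integrable.norm.const_mul _) (hTle m)
  have hTs : Summable fun m => ∫ z, ‖T m z‖ :=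
    Summable.of_nonneg_of_le (fun m => integral_nonneg fun z => norm_nonneg _) hTint
      ((hw.mul_left B).mul_right _)
  have hsum : ∀ z, HasSum (fun m => T m z) (η z * timeFreqShift z.1 z.2 (deltaTrain a c) φ) :=
    fun z => (hasSum_timeFreqShift_deltaTrain ha c φ z.1 z.2).mul_left _
  have hTtsum : ∀ z, η z * timeFreqShift z.1 z.2 (deltaTrain a c) φ = ∑' m, T m z :=
    fun z => (hsum z).tsum_eq.symm
  constructor
  · refine (hη.integrable.norm.const_mul (∑' m, B * w m)).mono' ?_ (Eventually.of_forall fun z => ?_)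
    · simp only [hTtsum]
      exact (Measurable.tsum hTm).aestronglyMeasurable
    · rw [hTtsum, ← tsum_mul_right]
      exact tsum_of_norm_bounded ((hw.mul_left B).mul_right _).hasSum fun m => hTle m z
  · simp only [hTtsum]
    rw [← (hasSum_integral_of_summable_integral_norm hTi hTs).tsum_eq]
    set T' : ℤ → ℝ × ℝ → ℂ := fun m z => T m (z + (-(a * m), 0)) with hT'
    have hT'i : ∀ m, Integrable (T' m) := fun m => (hTi m).comp_add_right _
    have hT'eq : ∀ m, ∫ z, T' m z = ∫ z, T m z := fun m =>
      integral_add_right_eq_self (T m) _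
    have hT'norm : ∀ m, ∫ z, ‖T' m z‖ = ∫ z, ‖T m z‖ := fun m =>
      integral_add_right_eq_self (fun z => ‖T m z‖) _
    have hT'val : ∀ m x ν, T' m (x, ν) =
        c (m : ZMod L) * (η (x - a * m, ν) * character ν x) * φ x := by
      intro m x ν
      simp only [hT', hT, Prod.mk_add_mk, add_zero, ← sub_eq_add_neg]
      rw [sub_add_cancel]
      ring
    set G : ℤ → ℝ → ℂ := fun m x => ∫ ν, T' m (x, ν) with hG
    have hGi : ∀ m, Integrable (G m) := by
      intro m
      have := hT'i m
      rw [Measure.volume_eq_prod] at this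
      exact this.integral_prod_left
    have hGint : ∀ m, ∫ x, G m x = ∫ z, T m z := by
      intro m
      have := hT'i m
      rw [Measure.volume_eq_prod] at this
      rw [← hT'eq, Measure.volume_eq_prod, integral_prod _ this]
    have hGs : Summable fun m => ∫ x, ‖G m x‖ := by
      refine Summable.of_nonneg_of_le (fun m => integral_nonneg fun z => norm_nonneg _)
        (fun m => ?_) hTs
      have := (hT'i m).norm
      rw [Measure.volume_eq_prod] at this
      rw [← hT'norm, Measure.volume_eq_prod, integral_prod _ this]
      exact integral_mono (hGi m).norm this.integral_prod_left fun x => norm_integral_le_integral_norm _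
    have hfG : ∀ x, deltaTrainResponse a c η x * φ x = ∑' m, G m x := by
      intro x
      rw [deltaTrainResponse, ← tsum_mul_right]
      refine tsum_congr fun m => ?_
      simp only [hG, hT'val]
      rw [integral_mul_const, integral_const_mul]
    simp only [hfG]
    rw [← (hasSum_integral_of_summable_integral_norm hGi hGs).tsum_eq]
    exact tsum_congr hGint

end IsSquareSupported

theorem ae_eq_of_integral_mul_schwartz_eq {f g : ℝ → ℂ} (hf : MemLp f 2) (hg : MemLp g 2)
    (h : ∀ φ : 𝓢(ℝ, ℂ), ∫ x, f x * φ x = ∫ x, g x * φ x) : f =ᵐ[volume] g := by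
  refine ae_eq_of_integral_contDiff_smul_eq (hf.locallyIntegrable (by norm_num))
    (hg.locallyIntegrable (by norm_num)) fun u hu hc => ?_
  have hu' : ContDiff ℝ (⊤ : ℕ∞) fun x => (u x : ℂ) := Complex.ofRealCLM.contDiff.comp hu
  have hc' : HasCompactSupport fun x => (u x : ℂ) := hc.comp_left Complex.ofReal_zero
  have := h (hc'.toSchwartzMap hu')
  simpa [Complex.real_smul, mul_comm] using this

/-! ### The reconstruction formula -/

section Reconstruction

variable {a b ε : ℝ} {L : ℕ} {k n : Fin L → ℤ} {α : Matrix (Fin L) (Fin L) ℂ} {c : ZMod L → ℂ}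
  {χ : ℝ × ℝ → ℂ}

/-- Among the lattice translates of the point only the `L` listed cells can carry mass of `η`, so
the double series collapses to `L` terms. Shifting by `ap` turns the weight index into `p - k i`,
the index in a column of the Gabor matrix. -/
theorem zakResponse_eq_sum (hinj : Function.Injective fun j => (k j, n j)) {η : ℝ × ℝ → ℂ}
    {τ ξ : ℝ} (hη : ∀ q : ℤ × ℤ, η (τ + a * q.1, ξ + b * q.2) ≠ 0 → ∃ j, (k j, n j) = q) (p : ℤ) :
    zakResponse a b c η (τ + a * p, ξ) = b * ∑ i, c ((p : ZMod L) - (k i : ZMod L)) *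
      (η (τ + a * k i, ξ + b * n i) * character (ξ + b * n i) (τ + a * p)) := by
  classical
  set f : ℤ × ℤ → ℂ := fun q => c (q.1 : ZMod L) *
    (η (τ + a * p - a * q.1, ξ + b * q.2) * character (ξ + b * q.2) (τ + a * p)) with hf
  set g : Fin L → ℤ × ℤ := fun i => (p - k i, n i) with hg
  have hginj : Function.Injective g := by
    intro i j hij
    simp only [hg, Prod.mk.injEq, sub_right_inj] at hij
    exact hinj (Prod.ext hij.1 hij.2)
  have hf0 : ∀ q ∉ Set.range g, f q = 0 := by
    intro q hq
    by_contra hne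
    have hη0 : η (τ + a * p - a * q.1, ξ + b * q.2) ≠ 0 := by
      intro h
      exact hne (by simp [hf, h])
    obtain ⟨j, hj⟩ := hη (p - q.1, q.2) (by
      convert hη0 using 3
      push_cast
      ring)
    refine hq ⟨j, ?_⟩
    rw [Prod.ext_iff] at hj ⊢
    simp only at hj
    simp only [hg, hj.1, hj.2, sub_sub_cancel, and_self]
  have hsum : HasSum f (∑ i, f (g i)) :=
    (hginj.hasSum_iff hf0).mp (hasSum_fintype (f ∘ g))
  rw [zakResponse]
  simp only [← tsum_mul_left (a := c _)]
  rw [← hsum.summable.tsum_prod, hsum.tsum_eq]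
  congr 1
  refine Finset.sum_congr rfl fun i _ => ?_
  simp only [hf, hg]
  congr 2
  · push_cast
    ring
  · congr 2
    push_cast
    ring

/-- Wherever the `j`-th cutoff is nonzero, the base point lies in the enlarged cell, the Zak samples
satisfy the Gabor linear system, and row `j` of `α` isolates `bη(z)`. Summing the cutoffs gives
`η(z)`, as `aL · b = 1`. The identity holds at every point and asks for no regularity of `χ`. -/
theorem reconstruct_zakResponse [NeZero L] (hab : a * b = 1 / (L : ℝ))
    (hα : α * gaborSubmatrix c k n = 1) (hinj : Function.Injective fun j => (k j, n j))
    (hχ : IsPartitionOfUnity a b ε χ) {η : ℝ × ℝ → ℂ}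
    (hη : ∀ w, η w ≠ 0 → ∀ q : ℤ × ℤ, w ∈ Ioo (a * q.1 - ε) (a * q.1 + (a + ε)) ×ˢ
      Ioo (b * q.2 - ε) (b * q.2 + (b + ε)) → ∃ j, (k j, n j) = q) (z : ℝ × ℝ) :
    reconstruct a b k n α χ (zakResponse a b c η) z = η z := by
  have hL : (L : ℂ) ≠ 0 := by exact_mod_cast NeZero.ne L
  have hL' : (L : ℝ) ≠ 0 := by exact_mod_cast NeZero.ne L
  have habC : (a : ℂ) * b = 1 / L := by exact_mod_cast hab
  have hlocal : ∀ j, χ (z.1 - a * k j, z.2 - b * n j) ≠ 0 →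
      ∑ p : Fin L, α j p * Complex.exp (-(2 * Real.pi * Complex.I) *
        ((z.2 * (z.1 + a * (((p : ℕ) : ℝ) - k j)) - a * b * n j * ((p : ℕ) : ℝ) : ℝ) : ℂ)) *
        zakResponse a b c η (z.1 + a * (((p : ℕ) : ℝ) - k j), z.2 - b * n j) = b * η z := by
    intro j hj
    obtain ⟨⟨h1, h2⟩, h3, h4⟩ := not_not.mp (mt (hχ.eq_zero _) hj)
    simp only at h1 h2 h3 h4
    set τ := z.1 - a * k j with hτ
    set ξ := z.2 - b * n j with hξ
    have hη' : ∀ q : ℤ × ℤ, η (τ + a * q.1, ξ + b * q.2) ≠ 0 → ∃ j, (k j, n j) = q := fun q hq =>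
      hη _ hq q ⟨⟨by linarith, by linarith⟩, by linarith, by linarith⟩
    -- These are the unknowns of the linear system. Their phases do not depend on `p`, and the phase
    -- is 1 for `i = j`.
    set e : Fin L → ℂ := fun i => Complex.exp (2 * Real.pi * Complex.I * (b * (n i - n j) * τ)) *
      η (τ + a * k i, ξ + b * n i) with he
    have hterm : ∀ p : Fin L, α j p * Complex.exp (-(2 * Real.pi * Complex.I) *
        ((z.2 * (z.1 + a * (((p : ℕ) : ℝ) - k j)) - a * b * n j * ((p : ℕ) : ℝ) : ℝ) : ℂ)) *
        zakResponse a b c η (z.1 + a * (((p : ℕ) : ℝ) - k j), ξ) =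
        b * ∑ i, α j p * gaborSubmatrix c k n p i * e i := by
      intro p
      have hx : z.1 + a * (((p : ℕ) : ℝ) - k j) = τ + a * ((p : ℕ) : ℤ) := by
        rw [hτ]
        push_cast
        ring
      have hz2 : z.2 = ξ + b * n j := by rw [hξ]; ring
      rw [hx, zakResponse_eq_sum hinj hη', mul_left_comm, Finset.mul_sum]
      congr 1
      refine Finset.sum_congr rfl fun i _ => ?_
      simp only [gaborSubmatrix, Matrix.of_apply, he, Int.cast_natCast]
      have hexp : Complex.exp (-(2 * Real.pi * Complex.I) *
          ((z.2 * (τ + a * ((p : ℕ) : ℝ)) - a * b * n j * ((p : ℕ) : ℝ) : ℝ) : ℂ)) *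
          character (ξ + b * n i) (τ + a * ((p : ℕ) : ℝ)) =
          Complex.exp (2 * Real.pi * Complex.I * (n i : ℂ) * ((p : ℕ) : ℂ) / (L : ℂ)) *
          Complex.exp (2 * Real.pi * Complex.I * (b * (n i - n j) * τ)) := by
        rw [character, ← Complex.exp_add, ← Complex.exp_add, hz2]
        congr 1
        push_cast
        have hdiv : (2 * Real.pi * Complex.I * (n i : ℂ) * ((p : ℕ) : ℂ) / (L : ℂ)) =
            2 * Real.pi * Complex.I * (n i : ℂ) * ((p : ℕ) : ℂ) * (a * b) := by
          rw [habC]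
          ring
        rw [hdiv]
        ring
      linear_combination (α j p * c (((p : ℕ) : ZMod L) - (k i : ZMod L)) *
        η (τ + a * k i, ξ + b * n i)) * hexp
    rw [Finset.sum_congr rfl fun p _ => hterm p, ← Finset.mul_sum, Finset.sum_comm]
    congr 1
    simp only [← Finset.sum_mul]
    have hid : ∀ i, ∑ p, α j p * gaborSubmatrix c k n p i = (1 : Matrix (Fin L) (Fin L) ℂ) j i := by
      intro i
      rw [← hα, Matrix.mul_apply]
    simp only [hid, Matrix.one_apply, ite_mul, one_mul, zero_mul, Finset.sum_ite_eq,
      Finset.mem_univ, if_true]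
    simp [he, hτ, hξ]
  have hcell : ∀ j, ∑ p : Fin L, α j p * Complex.exp (-(2 * Real.pi * Complex.I) *
        ((z.2 * (z.1 + a * (((p : ℕ) : ℝ) - k j)) - a * b * n j * ((p : ℕ) : ℝ) : ℝ) : ℂ)) *
        χ (z.1 - a * k j, z.2 - b * n j) *
        zakResponse a b c η (z.1 + a * (((p : ℕ) : ℝ) - k j), z.2 - b * n j) =
      χ (z.1 - a * k j, z.2 - b * n j) * (b * η z) := by
    intro j
    by_cases hj : χ (z.1 - a * k j, z.2 - b * n j) = 0
    · simp [hj]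
    · rw [← hlocal j hj, Finset.mul_sum]
      exact Finset.sum_congr rfl fun p _ => by ring
  rw [reconstruct, Finset.sum_congr rfl fun j _ => hcell j, ← Finset.sum_mul]
  by_cases hz : η z = 0
  · simp [hz]
  have hχsum : ∑ j, χ (z.1 - a * k j, z.2 - b * n j) = 1 := by
    -- The partition of unity translates by `+(ak, bn)` and the formula by `-(ak_j, bn_j)`, hence
    -- the signs. Where `η(z) ≠ 0`, all translates outside this list vanish at `z`.
    set g : Fin L → ℤ × ℤ := fun j => (-k j, -n j) with hg
    have hginj : Function.Injective g := by
      intro i j hij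
      simp only [hg, Prod.mk.injEq, neg_inj] at hij
      exact hinj (Prod.ext hij.1 hij.2)
    have h := hχ.hasSum z.1 z.2
    rw [← hginj.hasSum_iff] at h
    · rw [← h.tsum_eq, tsum_fintype]
      refine Finset.sum_congr rfl fun j _ => ?_
      simp [hg, sub_eq_add_neg]
    · intro q hq
      by_contra hne
      obtain ⟨⟨h1, h2⟩, h3, h4⟩ := not_not.mp (mt (hχ.eq_zero _) hne)
      simp only at h1 h2 h3 h4
      obtain ⟨j, hj⟩ := hη z hz (-q.1, -q.2) (by
        refine ⟨⟨?_, ?_⟩, ?_, ?_⟩ <;> push_cast <;> linarith)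
      rw [Prod.ext_iff] at hj
      simp only at hj
      exact hq ⟨j, by simp [hg, hj.1, hj.2]⟩
  rw [hχsum, one_mul]
  linear_combination (L : ℂ) * η z * habC + η z * mul_one_div_cancel hL

theorem reconstruct_sub (Y Z : ℝ × ℝ → ℂ) (z : ℝ × ℝ) :
    reconstruct a b k n α χ Y z - reconstruct a b k n α χ Z z =
      reconstruct a b k n α χ (fun w => Y w - Z w) z := by
  simp only [reconstruct, mul_sub, Finset.sum_sub_distrib]

/-- A bounded partition of unity makes the reconstruction formula local and bounded. -/
theorem exists_enorm_reconstruct_sq_le (ha : 0 < a) (hb : 0 < b)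
    (hχ : IsPartitionOfUnity a b ε χ) {B : ℝ} (hB : ∀ z, ‖χ z‖ ≤ B) :
    ∃ (X : ℝ) (K : Fin L × Fin L → ℝ≥0∞) (v : Fin L × Fin L → ℝ × ℝ), (∀ i, K i < ⊤) ∧
      ∀ (Y : ℝ × ℝ → ℂ) (z : ℝ × ℝ), ‖reconstruct a b k n α χ Y z‖ₑ ^ 2 ≤
        ∑ i, K i * (Icc (-X) X ×ˢ Icc (-X) X).indicator (fun w => ‖Y w‖ₑ ^ 2) (z + v i) := by
  refine ⟨a + b + ε + a * L, fun i => ‖(a * L : ℂ)‖ₑ ^ 2 *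
    ((Finset.univ : Finset (Fin L × Fin L)).card * (‖α i.1 i.2‖ₑ ^ 2 * ENNReal.ofReal B ^ 2)),
    fun i => (a * (((i.2 : ℕ) : ℝ) - k i.1), -(b * n i.1)), fun i => ?_, fun Y z => ?_⟩
  · exact ENNReal.mul_lt_top (ENNReal.pow_lt_top enorm_lt_top) (ENNReal.mul_lt_top
      (ENNReal.natCast_lt_top _) (ENNReal.mul_lt_top (ENNReal.pow_lt_top enorm_lt_top)
        (ENNReal.pow_lt_top ENNReal.ofReal_lt_top)))
  rw [reconstruct, ← Finset.sum_product', enorm_mul, mul_pow]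
  refine (mul_le_mul_right (enorm_sum_sq_le _ _) _).trans ?_
  rw [Finset.univ_product_univ, Finset.mul_sum, Finset.mul_sum]
  refine Finset.sum_le_sum fun i _ => ?_
  beta_reduce
  rw [mul_assoc (‖(a * L : ℂ)‖ₑ ^ 2), mul_assoc (Nat.cast _)]
  refine mul_le_mul_right (mul_le_mul_right ?_ _) _
  set x := z.1 + a * (((i.2 : ℕ) : ℝ) - k i.1) with hx
  set ξ := z.2 - b * n i.1 with hξ
  have hzv : z + (a * (((i.2 : ℕ) : ℝ) - k i.1), -(b * n i.1)) = (x, ξ) := by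
    rw [hx, hξ, sub_eq_add_neg z.2]
    rfl
  rw [hzv]
  by_cases hj : χ (z.1 - a * k i.1, ξ) = 0
  · simp [hj]
  obtain ⟨⟨h1, h2⟩, h3, h4⟩ := not_not.mp (mt (hχ.eq_zero _) hj)
  simp only at h1 h2 h3 h4
  have hp0 : (0 : ℝ) ≤ a * ((i.2 : ℕ) : ℝ) := by positivity
  have hpL : a * ((i.2 : ℕ) : ℝ) ≤ a * L :=
    mul_le_mul_of_nonneg_left (by exact_mod_cast i.2.2.le) ha.le
  have hxe : x = z.1 - a * k i.1 + a * ((i.2 : ℕ) : ℝ) := by rw [hx]; ring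
  rw [indicator_of_mem (by
    refine ⟨⟨?_, ?_⟩, ?_, ?_⟩ <;> simp only <;> linarith)]
  rw [enorm_mul, enorm_mul, enorm_mul, mul_pow, mul_pow, mul_pow]
  have he : ‖Complex.exp (-(2 * Real.pi * Complex.I) *
      ((z.2 * x - a * b * n i.1 * ((i.2 : ℕ) : ℝ) : ℝ) : ℂ))‖ₑ = 1 := by
    rw [← ofReal_norm, Complex.norm_exp]
    simp
  rw [he, one_pow, mul_one]
  gcongr
  rw [← ofReal_norm]
  exact ENNReal.ofReal_le_ofReal (hB _)

end Reconstruction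

/-! ### Uniqueness of responses and of Zak transforms -/

theorem zakPartialSum_ae_congr {a : ℝ} {L : ℕ} {f g : ℝ → ℂ} (h : f =ᵐ[volume] g) (N : ℕ) :
    zakPartialSum a L N f =ᵐ[volume] zakPartialSum a L N g := by
  have h1 : ∀ᵐ z : ℝ × ℝ, ∀ n : ℤ, f (z.1 - a * n * L) = g (z.1 - a * n * L) := by
    rw [ae_all_iff]
    intro n
    rw [Measure.volume_eq_prod]
    exact ((measurePreserving_sub_right volume (a * (n : ℝ) * L)).quasiMeasurePreserving.comp
      Measure.quasiMeasurePreserving_fst).ae h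
  filter_upwards [h1] with z hz
  simp only [zakPartialSum, hz]

theorem IsZakTransform.congr_ae {a : ℝ} {L : ℕ} {f g : ℝ → ℂ} {F : ℝ × ℝ → ℂ}
    (hF : IsZakTransform a L f F) (h : f =ᵐ[volume] g) : IsZakTransform a L g F := by
  intro K hK
  refine (hF K hK).congr fun N => lintegral_congr_ae (ae_restrict_of_ae ?_)
  filter_upwards [zakPartialSum_ae_congr h N] with z hz
  rw [hz]

theorem IsZakTransform.ae_eq {a : ℝ} {L : ℕ} {f : ℝ → ℂ} {F G : ℝ × ℝ → ℂ} (hf : Measurable f)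
    (hFm : Measurable F) (hGm : Measurable G) (hF : IsZakTransform a L f F)
    (hG : IsZakTransform a L f G) : F =ᵐ[volume] G := by
  have hloc : ∀ X : ℕ, ∀ᵐ z ∂(volume.restrict (Metric.closedBall (0 : ℝ × ℝ) X)), F z = G z := by
    intro X
    set μ := volume.restrict (Metric.closedBall (0 : ℝ × ℝ) X) with hμ
    have hK := isCompact_closedBall (0 : ℝ × ℝ) X
    have hle : ∀ N : ℕ, ∫⁻ z, ‖F z - G z‖ₑ ^ 2 ∂μ ≤ 2 * (∫⁻ z, ‖F z - zakPartialSum a L N f z‖ₑ ^ 2 ∂μ +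
        ∫⁻ z, ‖G z - zakPartialSum a L N f z‖ₑ ^ 2 ∂μ) := by
      intro N
      have hm : Measurable fun z => ‖F z - zakPartialSum a L N f z‖ₑ ^ 2 :=
        (hFm.sub (measurable_zakPartialSum_path N hf)).enorm.pow_const 2
      rw [← lintegral_add_left hm, ← lintegral_const_mul' _ _ (by simp)]
      refine lintegral_mono fun z => ?_
      have h := enorm_sum_sq_le (Finset.univ : Finset (Fin 2))
        ![F z - zakPartialSum a L N f z, -(G z - zakPartialSum a L N f z)]
      simp only [Fin.sum_univ_two, Matrix.cons_val_zero, Matrix.cons_val_one, enorm_neg,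
        Finset.card_univ, Fintype.card_fin, Nat.cast_ofNat] at h
      convert h using 3
      ring
    have h0 : ∫⁻ z, ‖F z - G z‖ₑ ^ 2 ∂μ = 0 := by
      have h1 := ENNReal.Tendsto.const_mul (a := 2) ((hF _ hK).add (hG _ hK)) (Or.inr (by simp))
      rw [add_zero, mul_zero] at h1
      exact le_antisymm (ge_of_tendsto' h1 hle) zero_le
    have h2 := (lintegral_eq_zero_iff ((hFm.sub hGm).enorm.pow_const 2)).mp h0
    filter_upwards [h2] with z hz
    simpa [sub_eq_zero] using hz
  have hU : (⋃ X : ℕ, Metric.closedBall (0 : ℝ × ℝ) X) = univ := Metric.iUnion_closedBall_nat 0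
  have := ae_restrict_iUnion_iff (μ := volume) (fun X : ℕ => Metric.closedBall (0 : ℝ × ℝ) X)
    (fun z => F z = G z)
  rw [hU, Measure.restrict_univ] at this
  exact this.mpr hloc

/-! ### From random paths to deterministic compactly supported spreading functions -/

namespace StochasticOperator

variable {Ω : Type*} [MeasurableSpace Ω] {P : Measure Ω} {H : StochasticOperator P}
  {S : Set (ℝ × ℝ)}

/-- The spreading function, set to zero off `S`. -/
noncomputable def spreadingOn (H : StochasticOperator P) (S : Set (ℝ × ℝ)) (z : ℝ × ℝ) (ω : Ω) : ℂ :=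
  S.indicator (fun w => H.spreading w ω) z

theorem measurable_spreadingOn (hS : MeasurableSet S) :
    Measurable (Function.uncurry (H.spreadingOn S)) := by
  have h : Function.uncurry (H.spreadingOn S) =
      (Prod.fst ⁻¹' S).indicator (Function.uncurry H.spreading) := by
    ext ⟨z, ω⟩
    by_cases hz : z ∈ S <;> simp [spreadingOn, hz]
  rw [h]
  exact H.measurable.indicator (measurable_fst hS)

theorem enorm_spreadingOn_le (z : ℝ × ℝ) (ω : Ω) : ‖H.spreadingOn S z ω‖ₑ ≤ ‖H.spreading z ω‖ₑ := by
  by_cases hz : z ∈ S <;> simp [spreadingOn, hz]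

theorem isSquareSupported_spreadingOn (hS : MeasurableSet S) {R : ℝ}
    (hR : ∀ z ∈ S, |z.1| ≤ R ∧ |z.2| ≤ R) (ω : Ω) :
    IsSquareSupported R fun z => H.spreadingOn S z ω where
  measurable := (measurable_spreadingOn hS).comp (measurable_id.prodMk measurable_const)
  eq_zero t ν h := by
    refine indicator_of_notMem (fun hz => ?_) _
    have := hR _ hz
    rcases h with h | h
    · exact absurd this.1 (not_le.mpr h)
    · exact absurd this.2 (not_le.mpr h)
  lintegral_lt_top := by
    refine lt_of_le_of_lt (lintegral_mono fun z => ?_)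
      ((memLp_two_iff_lintegral_lt_top (H.memLp_path ω).1).mp (H.memLp_path ω))
    exact pow_le_pow_left₀ zero_le (enorm_spreadingOn_le z ω) 2

/-- Off `S` the diagonal value of the autocorrelation, which is `E|η(z)|²`, vanishes. -/
theorem spreading_ae_eq_spreadingOn (hH : H ∈ StOPW P (S ×ˢ S)) (z : ℝ × ℝ) :
    ∀ᵐ ω ∂P, H.spreading z ω = H.spreadingOn S z ω := by
  by_cases hz : z ∈ S
  · simp [spreadingOn, hz]
  have h0 : H.autocorrelation (z, z) = 0 := by
    refine image_eq_zero_of_notMem_tsupport fun h => hz (hH.2 h).1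
  have hint := (memLp_two_iff_integrable_sq_norm (H.memLp_var z).1).mp (H.memLp_var z)
  have h1 : ∫ ω, ‖H.spreading z ω‖ ^ 2 ∂P = 0 := by
    have h2 : H.autocorrelation (z, z) = ((∫ ω, ‖H.spreading z ω‖ ^ 2 ∂P : ℝ) : ℂ) := by
      rw [autocorrelation, ← integral_complex_ofReal]
      refine integral_congr_ae (Eventually.of_forall fun ω => ?_)
      simp only
      rw [Complex.mul_conj, Complex.normSq_eq_norm_sq]
    rw [h0] at h2
    exact_mod_cast h2.symm
  rw [integral_eq_zero_iff_of_nonneg (fun ω => sq_nonneg _) hint] at h1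
  filter_upwards [h1] with ω hω
  simpa [spreadingOn, hz] using hω

/-- The exceptional null set of `ω` depends on `z`; Fubini trades it for a null set of `z` depending
on `ω`, which the integrals defining the response ignore. -/
theorem ae_spreading_eq_spreadingOn [SFinite P] (hS : MeasurableSet S)
    (hH : H ∈ StOPW P (S ×ˢ S)) :
    ∀ᵐ ω ∂P, ∀ᵐ z : ℝ × ℝ, H.spreading z ω = H.spreadingOn S z ω :=
  (Measure.ae_ae_comm (p := fun z ω => H.spreading z ω = H.spreadingOn S z ω)
    (measurableSet_eq_fun H.measurable (measurable_spreadingOn hS))).mp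
    (Eventually.of_forall (spreading_ae_eq_spreadingOn hH))

variable {a b R : ℝ} {L : ℕ} {c : ZMod L → ℂ}

theorem isResponse_deltaTrainResponse [SFinite P] [NeZero L] (ha : 0 < a) (hb : 0 < b)
    (hab : a * L * b = 1) (hS : MeasurableSet S) (hR : ∀ z ∈ S, |z.1| ≤ R ∧ |z.2| ≤ R)
    (hH : H ∈ StOPW P (S ×ˢ S)) :
    H.IsResponse (deltaTrain a c)
      fun x ω => deltaTrainResponse a c (fun z => H.spreadingOn S z ω) x where
  measurable := measurable_deltaTrainResponse c (measurable_spreadingOn hS)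
  memLp := by
    refine Eventually.of_forall fun ω => ?_
    have hη := isSquareSupported_spreadingOn (H := H) hS hR ω
    exact (memLp_two_iff_lintegral_lt_top (measurable_deltaTrainResponse_path c
      hη.measurable).aestronglyMeasurable).mpr (hη.lintegral_deltaTrainResponse_lt_top ha hb hab c)
  integrable := by
    filter_upwards [ae_spreading_eq_spreadingOn hS hH] with ω hω φ
    refine ((isSquareSupported_spreadingOn (H := H) hS hR ω).integral_deltaTrainResponse_mul
      ha c φ).1.congr ?_
    filter_upwards [hω] with z hz
    rw [pairingIntegrand, hz]
  integral_eq := by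
    filter_upwards [ae_spreading_eq_spreadingOn hS hH] with ω hω φ
    rw [((isSquareSupported_spreadingOn (H := H) hS hR ω).integral_deltaTrainResponse_mul ha c φ).2]
    refine integral_congr_ae ?_
    filter_upwards [hω] with z hz
    rw [pairingIntegrand, hz]

theorem IsResponse.ae_eq {u : 𝓢'(ℝ, ℂ)} {f g : ℝ → Ω → ℂ} (hf : H.IsResponse u f)
    (hg : H.IsResponse u g) : ∀ᵐ ω ∂P, (fun x => f x ω) =ᵐ[volume] fun x => g x ω := by
  filter_upwards [hf.memLp, hg.memLp, hf.integral_eq, hg.integral_eq] with ω h1 h2 h3 h4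
  exact ae_eq_of_integral_mul_schwartz_eq h1 h2 fun φ => (h3 φ).trans (h4 φ).symm

theorem isStochasticZakTransform_zakResponse [SFinite P] [NeZero L] (ha : 0 < a) (hb : 0 < b)
    (hab : a * L * b = 1) (hS : MeasurableSet S) (hR : ∀ z ∈ S, |z.1| ≤ R ∧ |z.2| ≤ R)
    (hH : H ∈ StOPW P (S ×ˢ S)) {f : ℝ → Ω → ℂ} (hf : H.IsResponse (deltaTrain a c) f) :
    IsStochasticZakTransform P a L f
      fun z ω => zakResponse a b c (fun w => H.spreadingOn S w ω) z where
  measurable := measurable_zakResponse c (measurable_spreadingOn hS)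
  isZak := by
    filter_upwards [hf.ae_eq (isResponse_deltaTrainResponse ha hb hab hS hR hH)] with ω hω
    exact ((isSquareSupported_spreadingOn (H := H) hS hR ω).isZakTransform ha hb hab c).congr_ae hω.symm

end StochasticOperator

/-! ### Mean-square reconstruction -/

theorem IsStochasticZakTransform.ae_ae_eq {Ω : Type*} [MeasurableSpace Ω] {P : Measure Ω} [SFinite P]
    {a : ℝ} {L : ℕ} {f : ℝ → Ω → ℂ} (hf : Measurable (Function.uncurry f))
    {F G : ℝ × ℝ → Ω → ℂ} (hF : IsStochasticZakTransform P a L f F)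
    (hG : IsStochasticZakTransform P a L f G) : ∀ᵐ z : ℝ × ℝ, ∀ᵐ ω ∂P, F z ω = G z ω := by
  -- Uniqueness is pathwise, for almost every `ω`; joint measurability lets Fubini turn it into
  -- almost sure equality at almost every `z`.
  refine (Measure.ae_ae_comm (p := fun z ω => F z ω = G z ω)
    (measurableSet_eq_fun hF.measurable hG.measurable)).mpr ?_
  filter_upwards [hF.isZak, hG.isZak] with ω h1 h2
  have hs : ∀ {Y : ℝ × ℝ → Ω → ℂ}, Measurable (Function.uncurry Y) → Measurable fun z => Y z ω :=
    fun hY => hY.comp (measurable_id.prodMk measurable_const)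
  exact IsZakTransform.ae_eq (hf.comp (measurable_id.prodMk measurable_const))
    (hs hF.measurable) (hs hG.measurable) h1 h2

theorem ae_reconstruct_congr {Ω : Type*} [MeasurableSpace Ω] {P : Measure Ω} {a b : ℝ} {L : ℕ}
    (k n : Fin L → ℤ) (α : Matrix (Fin L) (Fin L) ℂ) (χ : ℝ × ℝ → ℂ) {F G : ℝ × ℝ → Ω → ℂ}
    (h : ∀ᵐ z : ℝ × ℝ, ∀ᵐ ω ∂P, F z ω = G z ω) :
    ∀ᵐ z : ℝ × ℝ, ∀ᵐ ω ∂P, reconstruct a b k n α χ (fun w => F w ω) z =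
      reconstruct a b k n α χ (fun w => G w ω) z := by
  have h1 : ∀ᵐ z : ℝ × ℝ, ∀ i : Fin L × Fin L, ∀ᵐ ω ∂P,
      F (z + (a * (((i.2 : ℕ) : ℝ) - k i.1), -(b * n i.1))) ω =
        G (z + (a * (((i.2 : ℕ) : ℝ) - k i.1), -(b * n i.1))) ω := by
    rw [ae_all_iff]
    intro i
    exact (measurePreserving_add_right volume
      ((a * (((i.2 : ℕ) : ℝ) - k i.1), -(b * n i.1)) : ℝ × ℝ)).quasiMeasurePreserving.ae h
  filter_upwards [h1] with z hz
  filter_upwards [ae_all_iff.mpr hz] with ω hω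
  simp only [reconstruct]
  congr 1
  refine Finset.sum_congr rfl fun j _ => Finset.sum_congr rfl fun p _ => ?_
  congr 1
  have := hω (j, p)
  rw [sub_eq_add_neg z.2]
  exact this

/-- Reconstruction is a finite sum of translates cut off to a fixed square, so its mean-square norm
on the whole plane is controlled by a local norm of its input. This is where local convergence of
the Zak series becomes global convergence of the reconstruction. -/
theorem exists_lintegral_reconstruct_le {Ω : Type*} [MeasurableSpace Ω] {P : Measure Ω} [SFinite P]
    {a b ε : ℝ} {L : ℕ} {k n : Fin L → ℤ} {α : Matrix (Fin L) (Fin L) ℂ} {χ : ℝ × ℝ → ℂ}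
    (ha : 0 < a) (hb : 0 < b) (hχ : IsPartitionOfUnity a b ε χ) {B : ℝ} (hB : ∀ z, ‖χ z‖ ≤ B) :
    ∃ (X : ℝ) (C : ℝ≥0∞), C < ⊤ ∧ ∀ Y : ℝ × ℝ → Ω → ℂ, Measurable (Function.uncurry Y) →
      ∫⁻ z, ∫⁻ ω, ‖reconstruct a b k n α χ (fun w => Y w ω) z‖ₑ ^ 2 ∂P ≤
        C * ∫⁻ ω, (∫⁻ z in Icc (-X) X ×ˢ Icc (-X) X, ‖Y z ω‖ₑ ^ 2) ∂P := by
  obtain ⟨X, K, v, hK, hle⟩ := exists_enorm_reconstruct_sq_le (k := k) (n := n) (α := α) ha hb hχ hB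
  refine ⟨X, ∑ i, K i, ENNReal.sum_lt_top.mpr fun i _ => hK i, fun Y hY => ?_⟩
  set s : Set (ℝ × ℝ) := Icc (-X) X ×ˢ Icc (-X) X with hs
  have hsm : MeasurableSet s := measurableSet_Icc.prod measurableSet_Icc
  set g : ℝ × ℝ → Ω → ℝ≥0∞ := fun z ω => s.indicator (fun w => ‖Y w ω‖ₑ ^ 2) z with hg
  have hgm : Measurable (Function.uncurry g) := by
    have h : Function.uncurry g =
        (Prod.fst ⁻¹' s).indicator (fun p => ‖Function.uncurry Y p‖ₑ ^ 2) := by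
      ext ⟨z, ω⟩
      by_cases hz : z ∈ s <;> simp [hg, hz]
    rw [h]
    exact (hY.enorm.pow_const 2).indicator (measurable_fst hsm)
  have hgz : ∀ z, Measurable fun ω => g z ω := fun z => hgm.comp measurable_prodMk_left
  have hgi : Measurable fun z => ∫⁻ ω, g z ω ∂P := hgm.lintegral_prod_right'
  calc ∫⁻ z, ∫⁻ ω, ‖reconstruct a b k n α χ (fun w => Y w ω) z‖ₑ ^ 2 ∂P
      ≤ ∫⁻ z, ∫⁻ ω, ∑ i, K i * g (z + v i) ω ∂P :=
        lintegral_mono fun z => lintegral_mono fun ω => hle _ z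
    _ = ∫⁻ z, ∑ i, K i * ∫⁻ ω, g (z + v i) ω ∂P := by
        refine lintegral_congr fun z => ?_
        rw [lintegral_finsetSum _ fun i _ => (hgz _).const_mul _]
        exact Finset.sum_congr rfl fun i _ => lintegral_const_mul' _ _ (hK i).ne
    _ = (∑ i, K i) * ∫⁻ z, ∫⁻ ω, g z ω ∂P := by
        have hgv : ∀ i, Measurable fun z => K i * ∫⁻ ω, g (z + v i) ω ∂P := fun i =>
          (hgi.comp (measurable_id.add_const (v i))).const_mul _
        rw [lintegral_finsetSum _ fun i _ => hgv i, Finset.sum_mul]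
        refine Finset.sum_congr rfl fun i _ => ?_
        rw [lintegral_const_mul' _ _ (hK i).ne,
          lintegral_add_right_eq_self fun z => ∫⁻ ω, g z ω ∂P]
    _ = _ := by
        rw [lintegral_lintegral_swap hgm.aemeasurable]
        congr 1
        exact lintegral_congr fun ω => lintegral_indicator hsm _

theorem meanSquareDist_eq_zero {Ω : Type*} [MeasurableSpace Ω] {P : Measure Ω} {X Y : Ω → ℂ}
    (h : X =ᵐ[P] Y) : meanSquareDist P X Y = 0 := by
  rw [meanSquareDist, lintegral_congr_ae (g := fun _ => 0), lintegral_zero]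
  filter_upwards [h] with ω hω
  simp [hω]

namespace StochasticOperator

variable {Ω : Type*} [MeasurableSpace Ω] {P : Measure Ω} {H : StochasticOperator P}
  {S : Set (ℝ × ℝ)} {a b ε R : ℝ} {L : ℕ} {c : ZMod L → ℂ} {k n : Fin L → ℤ}
  {α : Matrix (Fin L) (Fin L) ℂ} {χ : ℝ × ℝ → ℂ} {f : ℝ → Ω → ℂ}

theorem reconstruct_zakResponse_spreadingOn [NeZero L] (hab : a * b = 1 / (L : ℝ))
    (hα : α * gaborSubmatrix c k n = 1) (hinj : Function.Injective fun j => (k j, n j))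
    (hχ : IsPartitionOfUnity a b ε χ)
    (hcover : ∀ w ∈ S, ∀ q : ℤ × ℤ, w ∈ Ioo (a * q.1 - ε) (a * q.1 + (a + ε)) ×ˢ
      Ioo (b * q.2 - ε) (b * q.2 + (b + ε)) → ∃ j, (k j, n j) = q) (z : ℝ × ℝ) (ω : Ω) :
    reconstruct a b k n α χ (zakResponse a b c fun w => H.spreadingOn S w ω) z =
      H.spreadingOn S z ω := by
  refine reconstruct_zakResponse hab hα hinj hχ (fun w hw => hcover w ?_) z
  by_contra h
  exact hw (indicator_of_notMem h _)

/-- Reconstruction is linear and exact on the full Zak transform, so the error is the reconstruction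
of the Zak remainder. For almost every `ω` the remainder tends to zero locally in `L²`, dominated by
a constant times the squared norm of the path, which is integrable over `ω` by `hfin`. -/
theorem tendsto_lintegral_meanSquareDist [SFinite P] [NeZero L] (ha : 0 < a) (hb : 0 < b)
    (hab : a * b = 1 / (L : ℝ)) (hS : MeasurableSet S) (hR : ∀ z ∈ S, |z.1| ≤ R ∧ |z.2| ≤ R)
    (hα : α * gaborSubmatrix c k n = 1) (hinj : Function.Injective fun j => (k j, n j))
    (hχ : IsPartitionOfUnity a b ε χ)
    (hcover : ∀ w ∈ S, ∀ q : ℤ × ℤ, w ∈ Ioo (a * q.1 - ε) (a * q.1 + (a + ε)) ×ˢ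
      Ioo (b * q.2 - ε) (b * q.2 + (b + ε)) → ∃ j, (k j, n j) = q)
    (hH : H ∈ StOPW P (S ×ˢ S)) (hf : H.IsResponse (deltaTrain a c) f)
    {B : ℝ} (hB : ∀ z, ‖χ z‖ ≤ B)
    (hfin : ∫⁻ z : ℝ × ℝ, ∫⁻ ω, ‖H.spreading z ω‖ₑ ^ 2 ∂P < ⊤) :
    Tendsto (fun N : ℕ => ∫⁻ z : ℝ × ℝ, meanSquareDist P (H.spreading z)
      (fun ω => reconstruct a b k n α χ (zakPartialSum a L N (fun x => f x ω)) z)) atTop (𝓝 0) := by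
  have hL : (L : ℝ) ≠ 0 := by exact_mod_cast NeZero.ne L
  have hab' : a * L * b = 1 := by
    rw [mul_right_comm, hab, one_div_mul_cancel hL]
  obtain ⟨X, C, hC, hrec⟩ := exists_lintegral_reconstruct_le (P := P) (k := k) (n := n) (α := α)
    ha hb hχ hB
  obtain ⟨C', hC', herr⟩ := IsSquareSupported.exists_lintegral_square_sub_zakPartialSum_le
    ha hb hab' c R X
  set s : Set (ℝ × ℝ) := Icc (-X) X ×ˢ Icc (-X) X with hs
  set F : ℝ × ℝ → Ω → ℂ := fun z ω => zakResponse a b c (fun w => H.spreadingOn S w ω) z with hF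
  set Y : ℕ → ℝ × ℝ → Ω → ℂ := fun N z ω => F z ω - zakPartialSum a L N (fun x => f x ω) z with hY
  have hYm : ∀ N, Measurable (Function.uncurry (Y N)) := fun N =>
    (measurable_zakResponse c (measurable_spreadingOn hS)).sub
      (measurable_zakPartialSum N hf.measurable)
  have hle : ∀ N, ∫⁻ z : ℝ × ℝ, meanSquareDist P (H.spreading z)
      (fun ω => reconstruct a b k n α χ (zakPartialSum a L N (fun x => f x ω)) z) ≤
        C * ∫⁻ ω, (∫⁻ z in s, ‖Y N z ω‖ₑ ^ 2) ∂P := by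
    intro N
    refine le_trans (lintegral_mono fun z => le_of_eq ?_) (hrec (Y N) (hYm N))
    refine lintegral_congr_ae ?_
    filter_upwards [spreading_ae_eq_spreadingOn hH z] with ω hω
    rw [hω, ← reconstruct_zakResponse_spreadingOn hab hα hinj hχ hcover z ω, reconstruct_sub]
  have hpath : ∀ᵐ ω ∂P, ∀ N, ∫⁻ z in s, ‖Y N z ω‖ₑ ^ 2 =
      ∫⁻ z in s, ‖F z ω - zakPartialSum a L N
        (deltaTrainResponse a c fun w => H.spreadingOn S w ω) z‖ₑ ^ 2 := by
    filter_upwards [hf.ae_eq (isResponse_deltaTrainResponse ha hb hab' hS hR hH)] with ω hω N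
    refine lintegral_congr_ae (ae_restrict_of_ae ?_)
    filter_upwards [zakPartialSum_ae_congr (a := a) (L := L) hω N] with z hz
    simp only [hY, hz]
  have hdct := tendsto_lintegral_of_dominated_convergence (μ := P)
    (F := fun N ω => ∫⁻ z in s, ‖Y N z ω‖ₑ ^ 2) (f := fun _ => 0)
    (fun ω => C' * ∫⁻ z, ‖H.spreadingOn S z ω‖ₑ ^ 2)
    (fun N => ((hYm N).enorm.pow_const 2).lintegral_prod_left')
    (fun N => by
      filter_upwards [hpath] with ω hω
      rw [hω N]
      exact (herr _ (isSquareSupported_spreadingOn hS hR ω)).1 N)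
    (by
      rw [lintegral_const_mul' _ _ hC'.ne]
      refine (ENNReal.mul_lt_top hC' ?_).ne
      rw [lintegral_lintegral_swap (f := fun ω z => ‖H.spreadingOn S z ω‖ₑ ^ 2)
        (((measurable_spreadingOn hS).enorm.pow_const 2).comp measurable_swap).aemeasurable]
      refine lt_of_le_of_lt (lintegral_mono fun z => lintegral_mono fun ω => ?_) hfin
      exact pow_le_pow_left₀ zero_le (enorm_spreadingOn_le z ω) 2)
    (by
      filter_upwards [hpath] with ω hω
      simp only [hω]
      exact (herr _ (isSquareSupported_spreadingOn hS hR ω)).2)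
  rw [lintegral_zero] at hdct
  have h3 := ENNReal.Tendsto.const_mul (a := C) hdct (Or.inr hC.ne)
  rw [mul_zero] at h3
  exact tendsto_of_tendsto_of_tendsto_of_le_of_le tendsto_const_nhds h3 (fun _ => zero_le) hle

end StochasticOperator

theorem mainTheorem1 (S : Set (ℝ × ℝ)) (hS : IsCompact S) (hμ : volume S < 1) :
    ∃ (L : ℕ) (a b ε : ℝ) (k n : Fin L → ℤ) (c : ZMod L → ℂ) (α : Matrix (Fin L) (Fin L) ℂ),
      L.Prime ∧ 0 < a ∧ 0 < b ∧ 0 < ε ∧ a * b = 1 / (L : ℝ) ∧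
      IsRectified a b k n S ∧
      α * gaborSubmatrix c k n = 1 ∧
      ∀ (Ω : Type*) [MeasurableSpace Ω] (P : Measure Ω) [IsProbabilityMeasure P]
        (H : StochasticOperator P), H ∈ StOPW P (S ×ˢ S) →
        (∃ f : ℝ → Ω → ℂ, H.IsResponse (deltaTrain a c) f) ∧
        ∀ f : ℝ → Ω → ℂ, H.IsResponse (deltaTrain a c) f →
          (∃ F : ℝ × ℝ → Ω → ℂ, IsStochasticZakTransform P a L f F) ∧
          ∀ χ : ℝ × ℝ → ℂ, IsPartitionOfUnity a b ε χ →
            (∀ F : ℝ × ℝ → Ω → ℂ, IsStochasticZakTransform P a L f F →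
              ∀ᵐ z : ℝ × ℝ, meanSquareDist P (H.spreading z)
                (fun ω => reconstruct a b k n α χ (fun w => F w ω) z) = 0) ∧
            ((∃ B : ℝ, ∀ z, ‖χ z‖ ≤ B) →
              ∫⁻ z : ℝ × ℝ, ∫⁻ ω, ‖H.spreading z ω‖ₑ ^ 2 ∂P < ⊤ →
              Tendsto (fun N : ℕ => ∫⁻ z : ℝ × ℝ, meanSquareDist P (H.spreading z)
                (fun ω => reconstruct a b k n α χ
                  (zakPartialSum a L N (fun x => f x ω)) z)) atTop (𝓝 0)) := by
  obtain ⟨L, M, s, J, hL, hs, hss, hcard, hJ, hSJ⟩ := exists_prime_sparse_lattice_cover hS hμ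
  have : NeZero L := ⟨hL.ne_zero⟩
  obtain ⟨k, n, c, hdet, hsurj, hinj⟩ :=
    exists_lattice_enumeration_gaborSubmatrix_det_ne_zero J hcard hJ
  have hL0 : (L : ℝ) ≠ 0 := by exact_mod_cast hL.ne_zero
  have hab' : s * L * s = 1 := by
    rw [mul_right_comm, hss, one_div_mul_cancel hL0]
  have hSm : MeasurableSet S := hS.measurableSet
  obtain ⟨R, hR⟩ : ∃ R : ℝ, ∀ z ∈ S, |z.1| ≤ R ∧ |z.2| ≤ R := by
    obtain ⟨R, hR⟩ := hS.isBounded.exists_norm_le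
    refine ⟨R, fun z hz => ?_⟩
    have := hR z hz
    rw [Prod.norm_def] at this
    exact max_le_iff.mp this
  have hcover : ∀ w ∈ S, ∀ q : ℤ × ℤ, w ∈ Ioo (s * q.1 - s) (s * q.1 + (s + s)) ×ˢ
      Ioo (s * q.2 - s) (s * q.2 + (s + s)) → ∃ j, (k j, n j) = q := fun w hw q hq =>
    hsurj q (hSJ w hw q (by rwa [two_mul]))
  have hα : (gaborSubmatrix c k n)⁻¹ * gaborSubmatrix c k n = 1 :=
    Matrix.nonsing_inv_mul _ (isUnit_iff_ne_zero.mpr hdet)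
  -- The cells are squares and the overlap is as large as the cell: `a = b = ε = s`.
  refine ⟨L, s, s, s, k, n, c, (gaborSubmatrix c k n)⁻¹, hL, hs, hs, hs, hss, ?_, hα, ?_⟩
  · intro z hz
    have hfloor : ∀ x : ℝ, s * ⌊x / s⌋ ≤ x ∧ x < s * ⌊x / s⌋ + s := by
      intro x
      have h1 := (le_div_iff₀ hs).mp (Int.floor_le (x / s))
      have h2 := (div_lt_iff₀ hs).mp (Int.lt_floor_add_one (x / s))
      constructor <;> linarith
    obtain ⟨h1, h2⟩ := hfloor z.1
    obtain ⟨h3, h4⟩ := hfloor z.2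
    -- The half-open cell containing `z` lies in its own open enlargement, so its index is among the
    -- listed ones.
    obtain ⟨j, hj⟩ := hcover z hz (⌊z.1 / s⌋, ⌊z.2 / s⌋)
      ⟨⟨by linarith, by linarith⟩, by linarith, by linarith⟩
    rw [Prod.ext_iff] at hj
    simp only at hj
    refine mem_iUnion.mpr ⟨j, ?_⟩
    rw [hj.1, hj.2]
    exact ⟨⟨h1, h2⟩, h3, h4⟩
  · intro Ω _ P _ H hH
    refine ⟨⟨_, StochasticOperator.isResponse_deltaTrainResponse hs hs hab' hSm hR hH⟩,
      fun f hf => ?_⟩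
    have hZ := StochasticOperator.isStochasticZakTransform_zakResponse hs hs hab' hSm hR hH hf
    refine ⟨⟨_, hZ⟩, fun χ hχ => ⟨fun F hF => ?_, fun ⟨B, hB⟩ hfin =>
      StochasticOperator.tendsto_lintegral_meanSquareDist hs hs hss hSm hR hα hinj hχ hcover hH hf
        hB hfin⟩⟩
    filter_upwards [ae_reconstruct_congr k n (gaborSubmatrix c k n)⁻¹ χ
      (hF.ae_ae_eq hf.measurable hZ)] with z hz
    refine meanSquareDist_eq_zero ?_
    filter_upwards [hz, StochasticOperator.spreading_ae_eq_spreadingOn hH z] with ω h1 h2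
    rw [h1, h2]
    exact (StochasticOperator.reconstruct_zakResponse_spreadingOn hss hα hinj hχ hcover z ω).symm
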